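/- Setting. Let $(X,d)$ be a proper geodesic metric space with base point $o\in X$, and let $G$ be a (discrete) group acting properly and by isometries on $X$. Write $\|g\|=d(o,go)$. For $A\subseteq G$ let $$\omega_A=\limsup_{n\to\infty}\frac1n\ln\#\{g\in A:\ d(o,go)\le n\}$$ be its growth rate; $A$ is growth tight if $\omega_A<\omega_G$. A closed set $Z\subseteq X$ is contracting if there is $C>0$ such that, for all $x,y\in X$ with $d(x,y)\le d(x,Z)$, one has $\operatorname{diam}(\pi_Z(x)\cup\pi_Z(y))\le C$, where $\pi_Z$ denotes the set of closest points in $Z$. An element $h\in G$ is contracting if $n\mapsto h^no$ $(n\in\mathbb Z)$ is a quasi-geodesic with contracting image. Put $E^+(h)=\{g\in G:\ gh^ng^{-1}=h^n \text{ for some } n\neq 0\}$ and let $E(G)=\bigcap_h E^+(h)$ over all contracting $h\in G$. A finite set $P\subseteq G$ is non-degenerate if $P\cap E(G)=\emptyset$, and it is a confining subset of a subgroup $H\le G$ if $g^{-1}Hg\cap P\setminus\{1\}\ne\emptyset$ for every $g\in G$. For $\theta,L,M>0$, an element $g\in G$ is $(\theta,L,M)$-admissible if there are an integer $m\ge\lfloor\theta\|g\|\rfloor$,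 elements $g_0=1,g_1,\dots,g_m=g$ of $G$, and points $x_0,\dots,x_m$ on a geodesic $[o,go]$ with $d(o,x_i)\le d(o,x_{i+1})$ for $0\le i<m$, such that $d(g_io,x_i)\le M$ for $0\le i\le m$ and $d(g_io,g_jo)\ge L$ for all $0\le i<j\le m$. Theorem. Assume that $G$ is non-elementary (neither finite nor virtually $\mathbb Z$), contains a contracting element, and satisfies $\omega_G<\infty$. Let $P\subseteq G$ be a finite non-degenerate set. Then for every $M>0$ there is $L>0$ such that for every $\theta>0$ there is $\delta>0$ with the following property. For every subgroup $H\le G$ having $P$ as a confining subset, and for every set $[G/H]\subseteq G$ containing exactly one element of each coset $Hg$, the set $$A_{\theta,L,M}=\{g\in[G/H]:\ g\text{ is }(\theta,L,M)\text{-admissible}\}$$ is growth tight, with a gap that is uniform in $H$ and in $[G/H]$: $$\omega_{A_{\theta,L,M}}<\omega_G\qquad\text{and}\qquad \omega_{A_{\theta,L,M}}+\delta\le\omega_G .$$ -/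

import Mathlib

open Set Filter

namespace ConfinedGrowth

/-- `γ`, restricted to `[0, d(x, y)]`, is a geodesic parametrized by arc length from `x` to `y`. -/
def IsGeodesic {X : Type*} [MetricSpace X] (γ : ℝ → X) (x y : X) : Prop :=
  γ 0 = x ∧ γ (dist x y) = y ∧
    ∀ s ∈ Icc (0 : ℝ) (dist x y), ∀ t ∈ Icc (0 : ℝ) (dist x y), dist (γ s) (γ t) = |s - t|

/-- Any two points are joined by a geodesic. -/
def IsGeodesicSpace (X : Type*) [MetricSpace X] : Prop :=
  ∀ x y : X, ∃ γ : ℝ → X, IsGeodesic γ x y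

/-- The set of closest point projections of `x` to `Z`. -/
def projSet {X : Type*} [MetricSpace X] (Z : Set X) (x : X) : Set X :=
  {y ∈ Z | dist x y = Metric.infDist x Z}

/-- The closed subset `Z` is `C`-contracting. In a proper space the projection sets are bounded,
so that `Metric.diam` is the honest diameter. -/
def IsContractingSet {X : Type*} [MetricSpace X] (C : ℝ) (Z : Set X) : Prop :=
  IsClosed Z ∧ 0 < C ∧
    ∀ x y : X, dist x y ≤ Metric.infDist x Z → Metric.diam (projSet Z x ∪ projSet Z y) ≤ C

/-- A sequence indexed by `ℤ` is a quasi-geodesic (a quasi-isometric embedding of `ℤ`). -/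
def IsQuasiGeodesic {X : Type*} [MetricSpace X] (u : ℤ → X) : Prop :=
  ∃ c : ℝ, 1 ≤ c ∧ ∀ m n : ℤ,
    |(m : ℝ) - n| / c - c ≤ dist (u m) (u n) ∧ dist (u m) (u n) ≤ c * |(m : ℝ) - n| + c

section Group

variable {G X : Type*} [Group G] [MetricSpace X] [MulAction G X]

/-- `h` is a contracting element: `n ↦ hⁿ o` is a quasi-geodesic with contracting image. -/
def IsContractingElement (o : X) (h : G) : Prop :=
  IsQuasiGeodesic (fun n : ℤ => h ^ n • o) ∧
    ∃ C : ℝ, IsContractingSet C (range fun n : ℤ => h ^ n • o)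

/-- `E⁺(h)`: the elements that commute with some nonzero power of `h`. -/
def EPlus (h : G) : Set G :=
  {g | ∃ n : ℤ, n ≠ 0 ∧ g * h ^ n * g⁻¹ = h ^ n}

/-- The elliptic radical `E(G)`: the intersection of `E⁺(h)` over all contracting `h`. -/
def ellipticRadical (G : Type*) {X : Type*} [Group G] [MetricSpace X] [MulAction G X] (o : X) :
    Set G :=
  {g | ∀ h : G, IsContractingElement o h → g ∈ EPlus h}

/-- The growth rate `ω_A = limsup (1/n) log #{g ∈ A | d(o, g o) ≤ n}` of a subset `A` of `G`,
with `log 0 = -∞` and `log ∞ = ∞`. -/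
noncomputable def growthRate (o : X) (A : Set G) : EReal :=
  ExpGrowth.expGrowthSup fun n : ℕ => ((A ∩ {g : G | dist o (g • o) ≤ n}).encard : ENNReal)

/-- `g` is `(θ, L, M)`-admissible: along some geodesic from `o` to `g o` there are linearly ordered
points `x 0, …, x m` that are `M`-close to orbit points `a 0 • o, …, a m • o`, where `a 0 = 1` and
`a m = g`, where `m` is at least the integer part of `θ d(o, g o)`, and where the orbit points are
pairwise at distance at least `L`. (The end points `x 0 = o`, `x m = g o` can always be used, and
intermediate points can be dropped, so only the number of intermediate points matters.) -/
def IsAdmissible (o : X) (θ L M : ℝ) (g : G) : Prop :=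
  ∃ γ : ℝ → X, IsGeodesic γ o (g • o) ∧
    ∃ (m : ℕ) (x : ℕ → X) (a : ℕ → G),
      ⌊θ * dist o (g • o)⌋₊ ≤ m ∧ a 0 = 1 ∧ a m = g ∧
      (∀ i ≤ m, x i ∈ γ '' Icc (0 : ℝ) (dist o (g • o))) ∧
      (∀ i < m, dist o (x i) ≤ dist o (x (i + 1))) ∧
      (∀ i ≤ m, dist (a i • o) (x i) ≤ M) ∧
      (∀ i j : ℕ, i < j → j ≤ m → L ≤ dist (a i • o) (a j • o))

end Group

/-- `P` is a confining subset of `H`: `g⁻¹ H g ∩ P ∖ {1}` is nonempty for every `g`. -/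
def IsConfiningSet {G : Type*} [Group G] (H : Subgroup G) (P : Finset G) : Prop :=
  ∀ g : G, ∃ p ∈ P, p ≠ 1 ∧ ∃ h ∈ H, p = g⁻¹ * h * g

/-- A group is elementary if it is finite or virtually infinite cyclic. -/
def IsElementary (G : Type*) [Group G] : Prop :=
  ∃ K : Subgroup G, IsCyclic K ∧ K.FiniteIndex

end ConfinedGrowth

open ConfinedGrowth

/-! Many elements of `H * g` are built from one admissible `g`. At each marked point `a i` on the
way from `o` to `g o` one may insert `β * p * β⁻¹` with `p ∈ P`; confinement at `a i * β` supplies a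
`p` for which this multiplies `g` on the left by an element of `H`. Subsets of the `m` positions
thus give `2 ^ m` products in the coset of `g`, each insertion costing length at most `D`. The
products are pairwise distinct for one `g`, and for different `g` they lie in different cosets,
since the transversal meets each coset once.

Distinctness is a ping-pong argument with translates of the axis of a contracting `h`. As `P` misses
the elliptic radical, B. H. Neumann's covering lemma yields conjugates of `P` avoiding `E⁺(h)`
(`exists_conj_notMem_EPlus`). Conjugating `q ∉ E⁺(h)` by a large power of `h` makes it throw every
point projecting near `o` far along the axis (`eventually_lt_dist_proj`). Three independent axes are
kept, so that at every position one of them is transverse to the geodesic in both directions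
(`exists_axisDist_le`). Behrstock's inequality then lets the projection to the axis at a position
detect whether something was inserted there (`insertionProd_injective`).

Summing `exp (-s d(o, g o))` over all products gives each `g` the weight `(1 + exp (-s D)) ^ m`,
which is at least a constant times `exp (δ d(o, g o))`. So the Poincaré series of the admissible set
converges at `s - δ` for every `s` in `(ω, ω + 1]`, with one `δ` for all these `s`, and `s → ω`
gives the gap. Divergence at `ω` is never needed. -/

namespace ConfinedGrowth

/-! ### Strong projections: coarse geometry and Behrstock's inequality -/

/-- `π` is a closest point projection to `Y` such that points with distant projections are joined
only by paths that come close to both projections. -/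
structure StrongProj {X : Type*} [MetricSpace X] (Y : Set X) (π : X → X) (K : ℝ) : Prop where
  mem : ∀ x, π x ∈ Y
  le : ∀ x, ∀ z ∈ Y, dist x (π x) ≤ dist x z
  sc : ∀ x y, dist (π x) (π y) ≤ K ∨
    dist x (π x) + dist (π x) (π y) + dist y (π y) ≤ dist x y + K

namespace StrongProj

variable {X : Type*} [MetricSpace X] {Y Z : Set X} {π σ : X → X} {K : ℝ}

lemma K_nonneg [Nonempty X] (hp : StrongProj Y π K) : 0 ≤ K := by
  obtain ⟨x⟩ := ‹Nonempty X›
  have h1 := dist_nonneg (x := x) (y := π x)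
  rcases hp.sc x x with h | h <;> simp only [dist_self] at h <;> linarith

lemma apply_eq (hp : StrongProj Y π K) {z : X} (hz : z ∈ Y) : π z = z := by
  have := hp.le z z hz
  rw [dist_self] at this
  exact (dist_le_zero.1 this).symm

lemma dist_proj_le_of_near (hp : StrongProj Y π K) {x z : X} {r : ℝ} (hr : 0 ≤ r) (hz : z ∈ Y)
    (h : dist x z ≤ dist x (π x) + r) : dist (π x) z ≤ K + r := by
  have hs := hp.sc x z
  rw [hp.apply_eq hz, dist_self] at hs
  rcases hs with hs | hs <;> linarith

lemma dist_proj_proj_le (hp : StrongProj Y π K) (x y : X) :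
    dist (π x) (π y) ≤ dist x y + K := by
  have h1 := dist_nonneg (x := x) (y := π x)
  have h2 := dist_nonneg (x := y) (y := π y)
  have h3 := dist_nonneg (x := x) (y := y)
  rcases hp.sc x y with h | h <;> linarith

/-- Quasiconvexity: if `t` were far from `Y`, the detours through `π t` from both ends would be too
long for an almost geodesic path. -/
lemma dist_self_proj_le (hp : StrongProj Y π K) {a b t : X} {ε : ℝ} (hε : 0 ≤ ε) (ha : a ∈ Y)
    (hb : b ∈ Y) (h : dist a t + dist t b ≤ dist a b + ε) : dist t (π t) ≤ 2 * K + ε := by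
  have : Nonempty X := ⟨a⟩
  have hK := hp.K_nonneg
  have h1 := hp.sc a t
  have h2 := hp.sc t b
  rw [hp.apply_eq ha, dist_self] at h1
  rw [hp.apply_eq hb, dist_self] at h2
  have h3 := dist_triangle a (π t) b
  have h4 := hp.le t a ha
  have h5 := hp.le t b hb
  rw [dist_comm t a] at h4
  have h6 := dist_nonneg (x := t) (y := π t)
  rcases h1 with h1 | h1 <;> rcases h2 with h2 | h2 <;> linarith

/-- Coarse monotonicity: a point almost on a geodesic from `s` to `b` cannot project much further
from `π s` than `b` does. -/
lemma dist_proj_mono (hp : StrongProj Y π K) {s a b : X} {ε : ℝ} (hε : 0 ≤ ε)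
    (h : dist s a + dist a b ≤ dist s b + ε) :
    dist (π s) (π a) ≤ dist (π s) (π b) + 2 * K + ε := by
  have : Nonempty X := ⟨a⟩
  have hK := hp.K_nonneg
  have h1 := hp.sc s a
  have h2 := hp.sc a b
  have h3 : dist s b ≤ dist s (π s) + dist (π s) (π b) + dist b (π b) := by
    have := dist_triangle4 s (π s) (π b) b
    rwa [dist_comm (π b) b] at this
  have h4 := dist_nonneg (x := a) (y := π a)
  have h5 := dist_nonneg (x := π s) (y := π b)
  have h6 := dist_nonneg (x := π a) (y := π b)
  have h7 := dist_triangle (π s) (π b) (π a)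
  rw [dist_comm (π b)] at h7
  rcases h1 with h1 | h1 <;> rcases h2 with h2 | h2 <;> linarith

/-- If both pairs of projections are far apart, `x` is closer to `Z` than to `Y` and conversely, up
to `K`; adding the two inequalities leaves only `2 * K`. -/
lemma behrstock (hp : StrongProj Y π K) (hq : StrongProj Z σ K) (x : X) :
    dist (π x) (π (σ x)) ≤ 2 * K ∨ dist (σ x) (σ (π x)) ≤ 2 * K := by
  have : Nonempty X := ⟨x⟩
  have hK := hp.K_nonneg
  rcases hp.sc x (σ x) with h | h
  · left; linarith
  rcases hq.sc x (π x) with h' | h'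
  · right; linarith
  have h1 := dist_nonneg (x := σ x) (y := π (σ x))
  have h2 := dist_nonneg (x := π x) (y := σ (π x))
  have h3 := dist_nonneg (x := σ x) (y := σ (π x))
  left; linarith

lemma dist_proj_le_of_hausdorff (hp : StrongProj Y π K) (hq : StrongProj Z σ K) {R : ℝ}
    (hYZ : ∀ y ∈ Y, ∃ z ∈ Z, dist y z ≤ R) (hZY : ∀ z ∈ Z, ∃ y ∈ Y, dist z y ≤ R) (x : X) :
    dist (π x) (σ x) ≤ K + 3 * R := by
  obtain ⟨y, hy, hy'⟩ := hZY _ (hq.mem x)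
  obtain ⟨z, hz, hz'⟩ := hYZ _ (hp.mem x)
  have hR : 0 ≤ R := dist_nonneg.trans hz'
  have h1 := hq.le x z hz
  have h2 := dist_triangle x (π x) z
  have h3 := dist_triangle x (σ x) y
  have h4 := hp.dist_proj_le_of_near (r := 2 * R) (by linarith) hy (x := x) (by linarith)
  have h5 := dist_triangle (π x) y (σ x)
  rw [dist_comm y] at h5
  linarith

lemma smul {G : Type*} [Group G] [MulAction G X] [IsIsometricSMul G X]
    (hp : StrongProj Y π K) (g : G) :
    StrongProj ((fun x => g • x) '' Y) (fun x => g • π (g⁻¹ • x)) K where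
  mem x := ⟨_, hp.mem _, rfl⟩
  le x := by
    rintro _ ⟨z, hz, rfl⟩
    have h := hp.le (g⁻¹ • x) z hz
    rw [← dist_smul g, ← dist_smul g _ z, smul_inv_smul] at h
    exact h
  sc x y := by
    have h := hp.sc (g⁻¹ • x) (g⁻¹ • y)
    rw [← dist_smul g (g⁻¹ • x) (π _), ← dist_smul g (g⁻¹ • y) (π _), dist_smul g⁻¹ x y,
      smul_inv_smul, smul_inv_smul] at h
    simpa only [dist_smul] using h

end StrongProj

/-! ### Contracting sets have strong projections -/

section Contracting

variable {X : Type*} [MetricSpace X] {Y : Set X} {π : X → X} {C : ℝ}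

/-- Along a geodesic that stays at distance at least `R` from `Y`, the projection moves slowly. -/
lemma dist_proj_le_of_far (hC : 0 < C)
    (hcon : ∀ x y, dist x y ≤ dist x (π x) → dist (π x) (π y) ≤ C)
    {γ : ℝ → X} {R : ℝ} (hR : 0 < R) (n : ℕ) :
    ∀ s t : ℝ, s ≤ t → t - s ≤ n * R →
      (∀ u ∈ Icc s t, ∀ v ∈ Icc s t, dist (γ u) (γ v) = |u - v|) →
      (∀ u ∈ Icc s t, R ≤ dist (γ u) (π (γ u))) → dist (π (γ s)) (π (γ t)) ≤ C * n := by
  induction n with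
  | zero =>
    intro s t hst hn _ _
    have : s = t := by simp at hn; linarith
    simp [this]
  | succ n ih =>
    intro s t hst hn hγ hfar
    by_cases h : t - s ≤ R
    · have h1 := hcon (γ s) (γ t) (by
        rw [hγ s ⟨le_rfl, hst⟩ t ⟨hst, le_rfl⟩, abs_sub_comm, abs_of_nonneg (by linarith)]
        exact h.trans (hfar s ⟨le_rfl, hst⟩))
      have : (0 : ℝ) ≤ C * n := by positivity
      push_cast; linarith
    · push Not at h
      have h1 := hcon (γ s) (γ (s + R)) (by
        rw [hγ s ⟨le_rfl, hst⟩ (s + R) ⟨by linarith, by linarith⟩, abs_sub_comm,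
          abs_of_nonneg (by linarith)]
        have := hfar s ⟨le_rfl, hst⟩
        linarith)
      have h2 := ih (s + R) t (by linarith) (by push_cast at hn; linarith)
        (fun u hu v hv => hγ u ⟨by linarith [hu.1], hu.2⟩ v ⟨by linarith [hv.1], hv.2⟩)
        (fun u hu => hfar u ⟨by linarith [hu.1], hu.2⟩)
      have h3 := dist_triangle (π (γ s)) (π (γ (s + R))) (π (γ t))
      push_cast; linarith

/-- Initial and final segments as long as the distance of their end point to `Y` project to sets of
size controlled by `C`. Only the remaining middle part moves the projection, by at most `C` for each
step of length `2 * C`. -/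
lemma dist_proj_le_of_far_of_long (hC : 0 < C)
    (hcon : ∀ x y, dist x y ≤ dist x (π x) → dist (π x) (π y) ≤ C)
    {γ : ℝ → X} {s t : ℝ} (hst : s ≤ t)
    (hγ : ∀ u ∈ Icc s t, ∀ v ∈ Icc s t, dist (γ u) (γ v) = |u - v|)
    (hfar : ∀ u ∈ Icc s t, 2 * C ≤ dist (γ u) (π (γ u))) :
    dist (π (γ s)) (π (γ t)) ≤ 2 * C ∨
    dist (γ s) (π (γ s)) + dist (γ t) (π (γ t)) + dist (π (γ s)) (π (γ t)) ≤ t - s + 6 * C := by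
  set r := dist (γ s) (π (γ s)) with hr
  set r' := dist (γ t) (π (γ t)) with hr'
  have hr0 : 0 ≤ r := dist_nonneg
  have hr0' : 0 ≤ r' := dist_nonneg
  by_cases h : t - s ≤ r + r'
  · left
    by_cases h' : t - s ≤ r
    · have := hcon (γ s) (γ t) (by
        rw [hγ s ⟨le_rfl, hst⟩ t ⟨hst, le_rfl⟩, abs_sub_comm, abs_of_nonneg (by linarith)]
        exact h')
      linarith
    · push Not at h'
      have h1 := hcon (γ s) (γ (s + r)) (by
        rw [hγ s ⟨le_rfl, hst⟩ (s + r) ⟨by linarith, by linarith⟩, abs_sub_comm,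
          abs_of_nonneg (by linarith)]
        linarith)
      have h2 := hcon (γ t) (γ (s + r)) (by
        rw [hγ t ⟨hst, le_rfl⟩ (s + r) ⟨by linarith, by linarith⟩,
          abs_of_nonneg (by linarith)]
        linarith)
      have h3 := dist_triangle (π (γ s)) (π (γ (s + r))) (π (γ t))
      rw [dist_comm (π (γ (s + r)))] at h3
      linarith
  · right
    push Not at h
    have h1 := hcon (γ s) (γ (s + r)) (by
      rw [hγ s ⟨le_rfl, hst⟩ (s + r) ⟨by linarith, by linarith⟩, abs_sub_comm,
        abs_of_nonneg (by linarith)]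
      linarith)
    have h2 := hcon (γ t) (γ (t - r')) (by
      rw [hγ t ⟨hst, le_rfl⟩ (t - r') ⟨by linarith, by linarith⟩,
        abs_of_nonneg (by linarith)]
      linarith)
    set n := ⌈(t - s - r - r') / (2 * C)⌉₊
    have hn1 : (t - s - r - r') / (2 * C) ≤ n := Nat.le_ceil _
    have hn2 : (n : ℝ) < (t - s - r - r') / (2 * C) + 1 := Nat.ceil_lt_add_one (by
      apply div_nonneg <;> linarith)
    rw [div_le_iff₀ (by linarith)] at hn1
    have h3 := dist_proj_le_of_far hC hcon (R := 2 * C) (by linarith) n (s + r) (t - r')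
      (by linarith) (by linarith)
      (fun u hu v hv => hγ u ⟨by linarith [hu.1], by linarith [hu.2]⟩ v
        ⟨by linarith [hv.1], by linarith [hv.2]⟩)
      (fun u hu => hfar u ⟨by linarith [hu.1], by linarith [hu.2]⟩)
    have h4 : C * n ≤ (t - s - r - r') / 2 + C := by
      have : C * n ≤ C * ((t - s - r - r') / (2 * C) + 1) := by gcongr
      have e : C * ((t - s - r - r') / (2 * C) + 1) = (t - s - r - r') / 2 + C := by
        field_simp
      linarith
    have h5 := dist_triangle4 (π (γ s)) (π (γ (s + r))) (π (γ (t - r'))) (π (γ t))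
    rw [dist_comm (π (γ (t - r'))) (π (γ t))] at h5
    have h6 := dist_nonneg (x := π (γ s)) (y := π (γ t))
    linarith

/-- A geodesic from `x` to `y` is cut at its first and last visit to the `2 * C`-neighbourhood of
`Y`. The outer pieces stay far from `Y`, and the inner one has both ends near `Y`. -/
lemma strongProj_of_contracting (hX : IsGeodesicSpace X) (hC : 0 < C)
    (hmem : ∀ x, π x ∈ Y) (hle : ∀ x, ∀ z ∈ Y, dist x (π x) ≤ dist x z)
    (hcon : ∀ x y, dist x y ≤ dist x (π x) → dist (π x) (π y) ≤ C) :
    StrongProj Y π (20 * C) := by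
  refine ⟨hmem, hle, fun x y => ?_⟩
  have hlip : ∀ a b : X, dist a (π a) ≤ dist a b + dist b (π b) := fun a b =>
    (hle a _ (hmem b)).trans (dist_triangle _ _ _)
  obtain ⟨γ, hγ0, hγ1, hγ⟩ := hX x y
  set ℓ := dist x y with hℓ
  have hℓ0 : 0 ≤ ℓ := dist_nonneg
  have hcγ : ContinuousOn γ (Icc 0 ℓ) := by
    refine (LipschitzOnWith.of_dist_le_mul (K := 1) fun s hs t ht => ?_).continuousOn
    rw [hγ s hs t ht]; simp [Real.dist_eq]
  have hcf : ContinuousOn (fun t => dist (γ t) (π (γ t))) (Icc 0 ℓ) := by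
    have h1 : Continuous fun z : X => dist z (π z) := by
      refine (LipschitzWith.of_dist_le_mul (K := 1) fun a b => ?_).continuous
      rw [Real.dist_eq, abs_le]
      have := hlip a b
      have h2 := hlip b a
      rw [dist_comm b a] at h2
      constructor <;> simp <;> linarith
    exact h1.comp_continuousOn hcγ
  set F := {t ∈ Icc 0 ℓ | dist (γ t) (π (γ t)) ≤ 2 * C} with hF
  have hFc : IsCompact F := by
    have : F = Icc 0 ℓ ∩ (fun t => dist (γ t) (π (γ t))) ⁻¹' Iic (2 * C) := rfl
    rw [this]
    exact isCompact_Icc.of_isClosed_subset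
      (hcf.preimage_isClosed_of_isClosed isClosed_Icc isClosed_Iic) inter_subset_left
  rcases F.eq_empty_or_nonempty with hE | hE
  · have hfar : ∀ u ∈ Icc 0 ℓ, 2 * C ≤ dist (γ u) (π (γ u)) := by
      intro u hu
      by_contra hcon'
      push Not at hcon'
      have : u ∈ F := ⟨hu, hcon'.le⟩
      rw [hE] at this
      exact this
    have := dist_proj_le_of_far_of_long hC hcon hℓ0 hγ hfar
    rw [hγ0, hγ1] at this
    rcases this with h | h
    · left; linarith
    · right; linarith
  · right
    obtain ⟨s, hs, hsl⟩ := hFc.exists_isLeast hE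
    obtain ⟨t, ht, htl⟩ := hFc.exists_isGreatest hE
    have hst : s ≤ t := hsl ht
    have hbd : ∀ u ∈ Icc 0 ℓ, u ≤ s ∨ t ≤ u → 2 * C ≤ dist (γ u) (π (γ u)) ∨ u = s ∨ u = t := by
      intro u hu hu'
      by_contra hcon'
      push Not at hcon'
      have hu2 : u ∈ F := ⟨hu, hcon'.1.le⟩
      rcases hu' with h | h
      · exact hcon'.2.1 (le_antisymm h (hsl hu2))
      · exact hcon'.2.2 (le_antisymm (htl hu2) h)
    have key : ∀ u ∈ Icc 0 ℓ, ∀ v ∈ Icc 0 ℓ, u ≤ v →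
        (∀ w, u ≤ w → w ≤ v → 2 * C ≤ dist (γ w) (π (γ w))) →
        dist (π (γ u)) (π (γ v)) ≤ 2 * C ∨
        dist (γ u) (π (γ u)) + dist (γ v) (π (γ v)) + dist (π (γ u)) (π (γ v))
          ≤ v - u + 6 * C := by
      intro u hu v hv huv hf
      exact dist_proj_le_of_far_of_long hC hcon huv
        (fun a ha b hb => hγ a ⟨hu.1.trans ha.1, ha.2.trans hv.2⟩ b
          ⟨hu.1.trans hb.1, hb.2.trans hv.2⟩) (fun a ha => hf a ha.1 ha.2)
    -- By continuity the first visit occurs on the boundary of the neighbourhood unless it is at the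
    -- start, so the estimate for far geodesics applies up to and including `s`.
    have hsF : 2 * C ≤ dist (γ s) (π (γ s)) ∨ s = 0 := by
      by_contra hcon'
      push Not at hcon'
      have hs0 : 0 < s := lt_of_le_of_ne hs.1.1 (Ne.symm hcon'.2)
      have h1 : ∀ᶠ u in nhdsWithin s (Icc 0 ℓ), dist (γ u) (π (γ u)) < 2 * C :=
        (hcf s hs.1).eventually (Iio_mem_nhds hcon'.1)
      have h2 : ∀ᶠ u in nhdsWithin s (Ico 0 s), dist (γ u) (π (γ u)) < 2 * C :=
        h1.filter_mono (nhdsWithin_mono _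
          (show Ico 0 s ⊆ Icc 0 ℓ from fun u hu => ⟨hu.1, hu.2.le.trans hs.1.2⟩))
      have h3 : (nhdsWithin s (Ico 0 s)).NeBot := by
        rw [← mem_closure_iff_nhdsWithin_neBot, closure_Ico hs0.ne]
        exact ⟨hs0.le, le_rfl⟩
      obtain ⟨u, hu, hu2⟩ := (h2.and self_mem_nhdsWithin).exists
      exact absurd (hsl ⟨⟨hu2.1, hu2.2.le.trans hs.1.2⟩, hu.le⟩) (not_le.2 hu2.2)
    have htF : 2 * C ≤ dist (γ t) (π (γ t)) ∨ t = ℓ := by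
      by_contra hcon'
      push Not at hcon'
      have hs0 : t < ℓ := lt_of_le_of_ne ht.1.2 hcon'.2
      have h1 : ∀ᶠ u in nhdsWithin t (Icc 0 ℓ), dist (γ u) (π (γ u)) < 2 * C :=
        (hcf t ht.1).eventually (Iio_mem_nhds hcon'.1)
      have h2 : ∀ᶠ u in nhdsWithin t (Ioc t ℓ), dist (γ u) (π (γ u)) < 2 * C :=
        h1.filter_mono (nhdsWithin_mono _
          (show Ioc t ℓ ⊆ Icc 0 ℓ from fun u hu => ⟨ht.1.1.trans hu.1.le, hu.2⟩))
      have h3 : (nhdsWithin t (Ioc t ℓ)).NeBot := by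
        rw [← mem_closure_iff_nhdsWithin_neBot, closure_Ioc hs0.ne]
        exact ⟨le_rfl, hs0.le⟩
      obtain ⟨u, hu, hu2⟩ := (h2.and self_mem_nhdsWithin).exists
      exact absurd (htl ⟨⟨ht.1.1.trans hu2.1.le, hu2.2⟩, hu.le⟩) (not_le.2 hu2.1)
    have e1 : dist x (π x) + dist (π x) (π (γ s)) ≤ s + 6 * C := by
      rcases hsF with h | h
      · have := key 0 (left_mem_Icc.2 hℓ0) s hs.1 hs.1.1 (fun w hw hw' => by
          rcases hbd w ⟨hw, hw'.trans hs.1.2⟩ (Or.inl hw') with h1 | h1 | h1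
          · exact h1
          · rw [h1]; exact h
          · have : w = s := le_antisymm hw' (h1 ▸ hst)
            rw [this]; exact h)
        have h2 := hlip (γ 0) (γ s)
        rw [hγ 0 (left_mem_Icc.2 hℓ0) s hs.1, abs_sub_comm, abs_of_nonneg (by linarith [hs.1.1])] at h2
        have h3 := hs.2
        rw [hγ0] at this h2
        rcases this with h4 | h4 <;> linarith
      · have h3 := hs.2
        rw [h, hγ0] at h3
        rw [h, hγ0, dist_self]; linarith
    have e2 : dist y (π y) + dist (π (γ t)) (π y) ≤ ℓ - t + 6 * C := by
      rcases htF with h | h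
      · have := key t ht.1 ℓ (right_mem_Icc.2 hℓ0) ht.1.2 (fun w hw hw' => by
          rcases hbd w ⟨ht.1.1.trans hw, hw'⟩ (Or.inr hw) with h1 | h1 | h1
          · exact h1
          · have : w = t := le_antisymm (h1 ▸ hst) hw
            rw [this]; exact h
          · rw [h1]; exact h)
        have h2 := hlip (γ ℓ) (γ t)
        rw [hγ ℓ (right_mem_Icc.2 hℓ0) t ht.1, abs_of_nonneg (by linarith [ht.1.2])] at h2
        have h3 := ht.2
        rw [hγ1] at this h2
        rcases this with h4 | h4 <;> linarith
      · have h3 := ht.2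
        rw [h, hγ1] at h3
        rw [h, hγ1, dist_self]; linarith
    have e3 : dist (π (γ s)) (π (γ t)) ≤ t - s + 4 * C := by
      have h1 := dist_triangle4 (π (γ s)) (γ s) (γ t) (π (γ t))
      rw [dist_comm (π (γ s)) (γ s), hγ s hs.1 t ht.1, abs_sub_comm,
        abs_of_nonneg (by linarith)] at h1
      linarith [hs.2, ht.2]
    have e4 := dist_triangle4 (π x) (π (γ s)) (π (γ t)) (π y)
    linarith

lemma exists_strongProj [ProperSpace X] (hX : IsGeodesicSpace X) (hY : Y.Nonempty)
    (hcon : IsContractingSet C Y) : ∃ π : X → X, StrongProj Y π (20 * C) := by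
  obtain ⟨hcl, hC, hc⟩ := hcon
  have hex : ∀ x : X, ∃ y, y ∈ projSet Y x := fun x => by
    obtain ⟨y, hy, h⟩ := hcl.exists_infDist_eq_dist hY x
    exact ⟨y, hy, h.symm⟩
  choose π hπ using hex
  have hbdd : ∀ x, Bornology.IsBounded (projSet Y x) := fun x =>
    Metric.isBounded_closedBall.subset (s := projSet Y x)
      (t := Metric.closedBall x (Metric.infDist x Y))
      (fun y hy => by rw [Metric.mem_closedBall, dist_comm, hy.2])
  refine ⟨π, strongProj_of_contracting hX hC (fun x => (hπ x).1) (fun x z hz => ?_)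
    (fun x y h => ?_)⟩
  · rw [(hπ x).2]; exact Metric.infDist_le_dist_of_mem hz
  · rw [(hπ x).2] at h
    exact (Metric.dist_le_diam_of_mem ((hbdd x).union (hbdd y)) (Or.inl (hπ x))
      (Or.inr (hπ y))).trans (hc x y h)

end Contracting

/-! ### The axis of a contracting element and its coarse stabilizer -/

section Axis

variable {G X : Type*} [Group G] [MetricSpace X] [MulAction G X]

/-- The orbit of `⟨h⟩` is quasi-isometrically embedded, and `π` is a strong projection to it. -/
structure IsAxis (o : X) (h : G) (π : X → X) (K c : ℝ) : Prop where
  one_le : 1 ≤ c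
  lower : ∀ m n : ℤ, |(m : ℝ) - n| / c - c ≤ dist (h ^ m • o) (h ^ n • o)
  upper : ∀ m n : ℤ, dist (h ^ m • o) (h ^ n • o) ≤ c * |(m : ℝ) - n| + c
  proj : StrongProj (range fun n : ℤ => h ^ n • o) π K

lemma IsContractingElement.exists_isAxis [ProperSpace X] (hX : IsGeodesicSpace X) {o : X} {h : G}
    (hh : IsContractingElement o h) : ∃ π K c, IsAxis o h π K c := by
  obtain ⟨⟨c, hc, hq⟩, C, hC⟩ := hh
  obtain ⟨π, hπ⟩ := exists_strongProj hX (range_nonempty _) hC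
  exact ⟨π, _, c, hc, fun m n => (hq m n).1, fun m n => (hq m n).2, hπ⟩

/-- The commensurator of `⟨h⟩`, that is, the coarse stabilizer of its orbits. -/
def axisStabilizer (h : G) : Subgroup G where
  carrier := {g | ∃ a b : ℤ, a ≠ 0 ∧ b ≠ 0 ∧ g * h ^ a * g⁻¹ = h ^ b}
  one_mem' := ⟨1, 1, one_ne_zero, one_ne_zero, by simp⟩
  mul_mem' := by
    rintro g g' ⟨a, b, ha, hb, e⟩ ⟨a', b', ha', hb', e'⟩
    refine ⟨a' * a, b * b', mul_ne_zero ha' ha, mul_ne_zero hb hb', ?_⟩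
    have h1 : g' * h ^ (a' * a) * g'⁻¹ = h ^ (a * b') := by
      rw [zpow_mul, ← conj_zpow, e', ← zpow_mul, mul_comm]
    have h2 : g * h ^ (a * b') * g⁻¹ = h ^ (b * b') := by
      rw [zpow_mul, ← conj_zpow, e, ← zpow_mul]
    rw [← h2, ← h1]; group
  inv_mem' := by
    rintro g ⟨a, b, ha, hb, e⟩
    exact ⟨b, a, hb, ha, by rw [← e]; group⟩

lemma zpow_mem_axisStabilizer (h : G) (k : ℤ) : h ^ k ∈ axisStabilizer h :=
  ⟨1, 1, one_ne_zero, one_ne_zero, by group⟩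

lemma finite_setOf_dist_le [ProperSpace X] [ProperlyDiscontinuousSMul G X] (o : X) (R : ℝ) :
    {g : G | dist o (g • o) ≤ R}.Finite := by
  refine (ProperlyDiscontinuousSMul.finite_disjoint_inter_image (Γ := G)
    (isCompact_singleton (x := o)) (isCompact_closedBall o R)).subset fun g hg => ?_
  exact ⟨g • o, ⟨o, rfl, rfl⟩, by rw [Metric.mem_closedBall, dist_comm]; exact hg⟩

namespace IsAxis

variable {o : X} {h : G} {π : X → X} {K c : ℝ}

lemma K_nonneg (ha : IsAxis o h π K c) : 0 ≤ K := by
  have : Nonempty X := ⟨o⟩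
  exact ha.proj.K_nonneg

lemma abs_div_sub_le (ha : IsAxis o h π K c) (n : ℤ) : |(n : ℝ)| / c - c ≤ dist o (h ^ n • o) := by
  have := ha.lower 0 n
  simpa using this

lemma dist_le_mul_abs (ha : IsAxis o h π K c) (n : ℤ) :
    dist o (h ^ n • o) ≤ c * |(n : ℝ)| + c := by
  have := ha.upper 0 n
  simpa using this

lemma exists_proj_eq (ha : IsAxis o h π K c) (x : X) : ∃ n : ℤ, h ^ n • o = π x := ha.proj.mem x

lemma proj_zpow (ha : IsAxis o h π K c) (n : ℤ) : π (h ^ n • o) = h ^ n • o :=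
  ha.proj.apply_eq ⟨n, rfl⟩

lemma proj_base (ha : IsAxis o h π K c) : π o = o := by
  simpa using ha.proj_zpow 0

/-- Powers of `h` move the base point arbitrarily far. -/
lemma tendsto_dist (ha : IsAxis o h π K c) :
    Tendsto (fun n : ℤ => dist o (h ^ n • o)) cofinite atTop := by
  have hc : 0 < c := by linarith [ha.one_le]
  refine tendsto_atTop_mono ha.abs_div_sub_le ?_
  refine tendsto_atTop_add_const_right _ (-c) (Tendsto.atTop_div_const hc ?_)
  rw [Int.cofinite_eq]
  refine Tendsto.sup (tendsto_abs_atBot_atTop.comp ?_) (tendsto_abs_atTop_atTop.comp ?_)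
  · exact tendsto_intCast_atBot_iff.2 tendsto_id
  · exact tendsto_intCast_atTop_atTop

lemma zpow_eq_one (ha : IsAxis o h π K c) {n : ℤ} (hn : h ^ n = 1) : n = 0 := by
  by_contra h0
  have h1 : Tendsto (fun k : ℤ => n * k) cofinite cofinite :=
    (mul_right_injective₀ h0).tendsto_cofinite
  have h2 := ((ha.tendsto_dist.comp h1).eventually_gt_atTop 0).exists
  obtain ⟨k, hk⟩ := h2
  simp [zpow_mul, hn] at hk

lemma zpow_injective (ha : IsAxis o h π K c) {m n : ℤ} (hmn : h ^ m = h ^ n) : m = n := by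
  have : h ^ (m - n) = 1 := by rw [zpow_sub, hmn, mul_inv_cancel]
  have := ha.zpow_eq_one this
  omega

variable [IsIsometricSMul G X]

/-- Orbit distances grow linearly, so a conjugation can distort exponents by at most `c ^ 2`
asymptotically. Iterating it `r` times would distort by `(|b| / |a|) ^ r`. -/
lemma abs_le_of_conj (ha : IsAxis o h π K c) {g : G} {a b : ℤ} (hb : b ≠ 0)
    (e : g * h ^ a * g⁻¹ = h ^ b) : |b| ≤ |a| := by
  have hc : 0 < c := by linarith [ha.one_le]
  have hr : ∀ r : ℕ, g ^ r * h ^ (a ^ r) * (g ^ r)⁻¹ = h ^ (b ^ r) := by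
    intro r
    induction r with
    | zero => simp
    | succ r ih =>
      have h1 : g * h ^ (b ^ r * a) * g⁻¹ = h ^ (b ^ r * b) := by
        rw [mul_comm _ a, zpow_mul, ← conj_zpow, e, ← zpow_mul, mul_comm b]
      have h2 : g ^ r * h ^ (a ^ r * a) * (g ^ r)⁻¹ = h ^ (b ^ r * a) := by
        rw [zpow_mul, ← conj_zpow, ih, ← zpow_mul]
      rw [pow_succ' g, pow_succ a, pow_succ b, ← h1, ← h2]; group
  have hk : ∀ (r : ℕ) , |(b : ℝ)| ^ r ≤ c ^ 2 * |(a : ℝ)| ^ r := by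
    intro r
    by_contra hlt
    push Not at hlt
    set D := dist o (g ^ r • o)
    -- The displacement `D` depends on `r` but not on `k`, so letting `k` grow removes the additive
    -- errors.
    have key : ∀ k : ℕ, k * (|(b : ℝ)| ^ r - c ^ 2 * |(a : ℝ)| ^ r) ≤ c * (2 * c + 2 * D) := by
      intro k
      have e1 : g ^ r * h ^ (a ^ r * k) * (g ^ r)⁻¹ = h ^ (b ^ r * k) := by
        rw [zpow_mul, ← conj_zpow, hr r, ← zpow_mul]
      have h1 := ha.abs_div_sub_le (b ^ r * k)
      have h2 := ha.dist_le_mul_abs (a ^ r * k)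
      have h3 : dist o (h ^ (b ^ r * k) • o) ≤ D + dist o (h ^ (a ^ r * k) • o) + D := by
        have e2 : (h ^ (b ^ r * (k : ℤ))) • o
            = g ^ r • h ^ (a ^ r * (k : ℤ)) • ((g ^ r)⁻¹ • o) := by
          rw [← e1, mul_smul, mul_smul]
        have e3 : dist o ((g ^ r)⁻¹ • o) = D := by
          rw [← dist_smul (g ^ r), smul_inv_smul, dist_comm]
        have := dist_triangle4 o (g ^ r • o) (g ^ r • h ^ (a ^ r * (k : ℤ)) • o)
          (g ^ r • h ^ (a ^ r * (k : ℤ)) • ((g ^ r)⁻¹ • o))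
        rw [dist_smul, dist_smul, dist_smul, e3] at this
        rw [e2]; exact this
      push_cast at h1 h2
      rw [abs_mul, abs_pow, Nat.abs_cast] at h1 h2
      have h4 : |(b : ℝ)| ^ r * k / c ≤ c * (|(a : ℝ)| ^ r * k) + 2 * c + 2 * D := by linarith
      rw [div_le_iff₀ hc] at h4
      nlinarith
    obtain ⟨k, hk⟩ := exists_nat_gt (c * (2 * c + 2 * D) / (|(b : ℝ)| ^ r - c ^ 2 * |(a : ℝ)| ^ r))
    rw [div_lt_iff₀ (by linarith)] at hk
    linarith [key k]
  by_contra hlt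
  push Not at hlt
  have hb0 : 0 < |b| := abs_pos.2 hb
  have h1 : (|a| : ℤ) + 1 ≤ |b| := hlt
  have h1' : |(a : ℝ)| + 1 ≤ |(b : ℝ)| := by exact_mod_cast h1
  rcases (abs_nonneg (a : ℝ)).eq_or_lt with h0 | h0
  · have := hk 1
    rw [← h0] at this
    rw [← h0] at h1'
    simp at this h1'
    rw [this] at h1'
    simp at h1'
    linarith
  · obtain ⟨r, hr'⟩ := pow_unbounded_of_one_lt (c ^ 2)
      (show 1 < |(b : ℝ)| / |(a : ℝ)| by rw [one_lt_div h0]; linarith)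
    rw [div_pow, lt_div_iff₀ (by positivity)] at hr'
    linarith [hk r]

lemma exists_pow_conj (ha : IsAxis o h π K c) {g : G} (hg : g ∈ axisStabilizer h) :
    ∃ n : ℕ, 0 < n ∧ (g * h ^ n * g⁻¹ = h ^ n ∨ g * h ^ n * g⁻¹ = (h ^ n)⁻¹) := by
  obtain ⟨a, b, ha0, hb0, e⟩ := hg
  have h1 := ha.abs_le_of_conj hb0 e
  have h2 := ha.abs_le_of_conj (g := g⁻¹) (a := b) (b := a) ha0 (by rw [← e]; group)
  have h3 : |a| = |b| := le_antisymm h2 h1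
  refine ⟨a.natAbs, Int.natAbs_pos.2 ha0, ?_⟩
  rcases abs_eq_abs.1 h3 with h4 | h4 <;> rcases Int.natAbs_eq a with h5 | h5
  · left; rw [← zpow_natCast, ← h5, e, h4]
  · left
    have h6 : h ^ a.natAbs = (h ^ a)⁻¹ := by rw [← zpow_natCast, ← zpow_neg]; congr 1; omega
    rw [h6, ← conj_inv, e, h4]
  · right; rw [← zpow_natCast, ← h5, e, ← zpow_neg, h4, neg_neg]
  · right
    have h6 : h ^ a.natAbs = (h ^ a)⁻¹ := by rw [← zpow_natCast, ← zpow_neg]; congr 1; omega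
    rw [h6, ← conj_inv, e, h4, zpow_neg, inv_inv]

/-- A point between distant projections of two points of `g Y` is close to both `Y` and `g Y`. -/
lemma exists_near_both (ha : IsAxis o h π K c) {g : G} {i j : ℤ} {t : X}
    (hd : K < dist (π (g • h ^ i • o)) (π (g • h ^ j • o)))
    (ht : dist (π (g • h ^ i • o)) t + dist t (π (g • h ^ j • o)) ≤
      dist (π (g • h ^ i • o)) (π (g • h ^ j • o))) :
    ∃ k l : ℤ, dist t (h ^ k • o) ≤ 2 * K ∧ dist t (g • h ^ l • o) ≤ 3 * K := by
  have hK := ha.K_nonneg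
  set a := g • h ^ i • o with ha'
  set b := g • h ^ j • o with hb'
  obtain ⟨k, hk⟩ := ha.exists_proj_eq t
  obtain ⟨l, hl⟩ := ha.exists_proj_eq (g⁻¹ • t)
  refine ⟨k, l, ?_, ?_⟩
  · rw [hk]
    have := ha.proj.dist_self_proj_le le_rfl (ha.proj.mem a) (ha.proj.mem b) (t := t) (by linarith)
    linarith
  · rw [hl]
    have h1 := (ha.proj.sc a b).resolve_left (not_le.2 hd)
    have h2 := dist_triangle a (π a) t
    have h3 := dist_triangle t (π b) b
    rw [dist_comm (π b) b] at h3
    have := (ha.proj.smul g).dist_self_proj_le hK (a := a) (b := b) (t := t)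
      ⟨_, ⟨i, rfl⟩, rfl⟩ ⟨_, ⟨j, rfl⟩, rfl⟩ (by linarith)
    linarith

/-- The axis and its translate by `g` run parallel for ever, hence come within `5 * K` of each other
somewhere. The bound does not depend on `g`, so the stabilizer consists of finitely many double
cosets of `⟨h⟩`. -/
lemma exists_zpow_mul_mul_zpow (ha : IsAxis o h π K c) {g : G} (hg : g ∈ axisStabilizer h) :
    ∃ k l : ℤ, dist o ((h ^ k * g * h ^ l) • o) ≤ 5 * K := by
  obtain ⟨a, b, ha0, hb0, e⟩ := hg
  have hK := ha.K_nonneg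
  -- The points `g o` and `h ^ (b * n) g o` project within `2 * dist o (g • o)` of `o` and `h ^ (b *
  -- n) o`, so this threshold puts their projections more than `K` apart.
  obtain ⟨n, hn⟩ := ((ha.tendsto_dist.comp
    (mul_right_injective₀ hb0).tendsto_cofinite).eventually_gt_atTop
      (K + 4 * dist o (g • o))).exists
  simp only [Function.comp] at hn
  have e1 : g • h ^ (a * n) • o = h ^ (b * n) • g • o := by
    rw [← mul_smul, ← mul_smul]
    congr 1
    rw [zpow_mul h b, ← e, conj_zpow, ← zpow_mul]; group
  have h1 := ha.proj.le (g • h ^ (a * n) • o) (h ^ (b * n) • o) ⟨_, rfl⟩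
  rw [e1, dist_smul, dist_comm (g • o)] at h1
  have h2 := ha.proj.le (g • o) o ⟨0, by simp⟩
  rw [dist_comm (g • o) o] at h2
  have h3 := dist_triangle4 (π (g • o)) (g • o) o (h ^ (b * n) • o)
  have h4 := dist_triangle4 o (g • o) (π (g • o)) (h ^ (b * n) • o)
  have h5 := dist_triangle4 (π (g • o)) (π (h ^ (b * n) • g • o)) (h ^ (b * n) • g • o)
    (h ^ (b * n) • o)
  rw [dist_comm (π (h ^ (b * n) • g • o)), dist_smul, dist_comm (g • o) o] at h5
  have h6 : K < dist (π (g • h ^ (0 : ℤ) • o)) (π (g • h ^ (a * n) • o)) := by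
    rw [e1, zpow_zero, one_smul]
    linarith
  obtain ⟨k, l, hk, hl⟩ := ha.exists_near_both h6 (t := π (g • h ^ (0 : ℤ) • o)) (by simp)
  refine ⟨-k, l, ?_⟩
  rw [mul_assoc, mul_smul, ← dist_smul (h ^ k), ← mul_smul, ← zpow_add, add_neg_cancel,
    zpow_zero, one_smul, mul_smul]
  have := dist_triangle_left (h ^ k • o) (g • h ^ l • o) (π (g • h ^ (0 : ℤ) • o))
  linarith

variable [ProperSpace X] [ProperlyDiscontinuousSMul G X]

/-- Translates of the axis that are not coarsely equal to it have bounded projections. -/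
lemma exists_proj_bound (ha : IsAxis o h π K c) (hX : IsGeodesicSpace X) :
    ∃ B : ℝ, 0 ≤ B ∧ ∀ g ∉ axisStabilizer h, ∀ i j : ℤ,
      dist (π (g • h ^ i • o)) (π (g • h ^ j • o)) ≤ B := by
  have hK := ha.K_nonneg
  set S := (finite_setOf_dist_le (G := G) o (5 * K)).toFinset with hS
  -- Sample points on a long common stretch each give an element `h ^ (-k) * g * h ^ l` of the
  -- finite set `S`; two must coincide. Spacing above `6 * K` makes both differences of exponents
  -- nonzero, so `g` would lie in the stabilizer.
  set J := 6 * K + 1 with hJ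
  refine ⟨S.card * J + K, by positivity, fun g hg i j => ?_⟩
  by_contra hcon
  push Not at hcon
  set a := π (g • h ^ i • o) with ha'
  set b := π (g • h ^ j • o) with hb'
  obtain ⟨γ, hγ0, hγ1, hγ⟩ := hX a b
  have hmem : ∀ n ∈ Finset.range (S.card + 1), (n : ℝ) * J ∈ Icc 0 (dist a b) := by
    intro n hn
    have hn' : (n : ℝ) ≤ S.card := by exact_mod_cast Finset.mem_range_succ_iff.1 hn
    have : (n : ℝ) * J ≤ S.card * J := by gcongr
    exact ⟨by positivity, by linarith⟩
  have hkl : ∀ n ∈ Finset.range (S.card + 1), ∃ k l : ℤ,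
      dist (γ (n * J)) (h ^ k • o) ≤ 2 * K ∧ dist (γ (n * J)) (g • h ^ l • o) ≤ 3 * K := by
    intro n hn
    have hn := hmem n hn
    refine ha.exists_near_both (i := i) (j := j) ?_ ?_
    · have : 0 ≤ S.card * J := by positivity
      linarith
    · rw [← ha', ← hb']
      have h1 := hγ 0 ⟨le_rfl, dist_nonneg⟩ _ hn
      have h2 := hγ _ hn (dist a b) ⟨dist_nonneg, le_rfl⟩
      rw [hγ0, zero_sub, abs_neg, abs_of_nonneg hn.1] at h1
      rw [hγ1, abs_sub_comm, abs_of_nonneg (by linarith [hn.2])] at h2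
      linarith
  choose! k l hk hl using hkl
  obtain ⟨n, hn, n', hn', hne, he⟩ := Finset.exists_ne_map_eq_of_card_lt_of_maps_to
    (s := Finset.range (S.card + 1)) (t := S) (by simp)
    (f := fun n => h ^ (-k n) * g * h ^ (l n)) (by
      intro n hn
      simp only [hS, Finite.coe_toFinset, mem_ofPred_eq]
      rw [mul_assoc, mul_smul, ← dist_smul (h ^ (k n)), ← mul_smul, ← zpow_add, add_neg_cancel,
        zpow_zero, one_smul, mul_smul]
      have := dist_triangle_left (h ^ k n • o) (g • h ^ l n • o) (γ (n * J))
      linarith [hk n hn, hl n hn])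
  have hfar : 6 * K < dist (γ (n * J)) (γ (n' * J)) := by
    rw [hγ _ (hmem n hn) _ (hmem n' hn'), ← sub_mul, abs_mul, abs_of_pos (by positivity : 0 < J)]
    have h1 : (1 : ℤ) ≤ |(n : ℤ) - n'| := Int.one_le_abs (by omega)
    have h2 : (1 : ℝ) ≤ |(n : ℝ) - n'| := by exact_mod_cast h1
    nlinarith
  refine hg ⟨l n - l n', k n - k n', fun h0 => ?_, fun h0 => ?_, ?_⟩
  · have h1 := hl n hn
    rw [sub_eq_zero.1 h0] at h1
    have := dist_triangle_right (γ (n * J)) (γ (n' * J)) (g • h ^ l n' • o)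
    linarith [hl n' hn']
  · have h1 := hk n hn
    rw [sub_eq_zero.1 h0] at h1
    have := dist_triangle_right (γ (n * J)) (γ (n' * J)) (h ^ k n' • o)
    linarith [hk n' hn']
  · have e1 : g * h ^ l n = h ^ k n * (h ^ (-k n) * g * h ^ l n) := by group
    rw [he] at e1
    have e2 : g * h ^ (l n - l n') * g⁻¹ = g * h ^ l n * (h ^ (-l n') * g⁻¹) := by group
    rw [e2, e1]
    group

/-- A uniform power of `h` is centralized or inverted by each element of the stabilizer. -/
lemma exists_uniform_pow (ha : IsAxis o h π K c) :
    ∃ N : ℕ, 0 < N ∧ ∀ g ∈ axisStabilizer h,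
      g * h ^ N * g⁻¹ = h ^ N ∨ g * h ^ N * g⁻¹ = (h ^ N)⁻¹ := by
  classical
  have hfin := finite_setOf_dist_le (G := G) o (5 * K)
  have hex : ∀ s ∈ axisStabilizer h, ∃ n : ℕ, 0 < n ∧
    (s * h ^ n * s⁻¹ = h ^ n ∨ s * h ^ n * s⁻¹ = (h ^ n)⁻¹) := fun s hs => ha.exists_pow_conj hs
  choose! ν hν hν' using hex
  set S := hfin.toFinset.filter (· ∈ axisStabilizer h) with hS
  refine ⟨∏ s ∈ S, ν s, Finset.prod_pos fun s hs => hν s (Finset.mem_filter.1 hs).2,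
    fun g hg => ?_⟩
  obtain ⟨k, l, hkl⟩ := ha.exists_zpow_mul_mul_zpow hg
  set s := h ^ k * g * h ^ l with hs
  have hsE : s ∈ axisStabilizer h :=
    mul_mem (mul_mem (zpow_mem_axisStabilizer h k) hg) (zpow_mem_axisStabilizer h l)
  have hsS : s ∈ S := by
    rw [hS, Finset.mem_filter, Finite.mem_toFinset]; exact ⟨hkl, hsE⟩
  obtain ⟨d, hd⟩ := Finset.dvd_prod_of_mem ν hsS
  set N := ∏ s ∈ S, ν s
  have hsN : s * h ^ N * s⁻¹ = h ^ N ∨ s * h ^ N * s⁻¹ = (h ^ N)⁻¹ := by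
    rw [hd, pow_mul, ← conj_pow, ← inv_pow]
    rcases hν' s hsE with h1 | h1
    · left; rw [h1]
    · right; rw [h1]
  have hg' : g * h ^ N * g⁻¹ = h ^ (-k) * (s * h ^ N * s⁻¹) * h ^ k := by
    rw [hs]
    have : h ^ l * h ^ N * (h ^ l)⁻¹ = h ^ N := by group
    calc g * h ^ N * g⁻¹ = g * (h ^ l * h ^ N * (h ^ l)⁻¹) * g⁻¹ := by rw [this]
      _ = _ := by group
  rw [hg']
  rcases hsN with h1 | h1
  · left; rw [h1]; group
  · right; rw [h1]; group

/-- `⟨h⟩` has finite index in the stabilizer. -/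
lemma exists_finset_transversal (ha : IsAxis o h π K c) {N : ℕ} (hN : 0 < N) :
    ∃ T : Finset G, ∀ g ∈ axisStabilizer h, ∃ s ∈ T, ∃ k : ℤ, g = h ^ (N * k) * s := by
  classical
  obtain ⟨N₀, hN₀, hconj⟩ := ha.exists_uniform_pow
  -- Exponents are reduced modulo `Q`: since `s` centralizes or inverts `h ^ N₀`, powers of `h ^ Q`
  -- can be moved past `s` to the left, leaving finitely many remainders.
  set Q := N * N₀ with hQ
  have hQ0 : 0 < (Q : ℤ) := by positivity
  have hfin := finite_setOf_dist_le (G := G) o (5 * K)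
  refine ⟨Finset.image (fun x : (G × ℕ) × ℕ => h ^ x.1.2 * x.1.1 * h ^ x.2)
    ((hfin.toFinset ×ˢ Finset.range Q) ×ˢ Finset.range Q), fun g hg => ?_⟩
  obtain ⟨k, l, hkl⟩ := ha.exists_zpow_mul_mul_zpow hg
  set s := h ^ k * g * h ^ l with hs
  have hsE : s ∈ axisStabilizer h :=
    mul_mem (mul_mem (zpow_mem_axisStabilizer h k) hg) (zpow_mem_axisStabilizer h l)
  have e1 : ∀ n : ℤ, h ^ n = h ^ (Q * (n / Q)) * h ^ (n % Q).toNat := by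
    intro n
    rw [← zpow_natCast, ← zpow_add, Int.toNat_of_nonneg (Int.emod_nonneg _ hQ0.ne')]
    congr 1
    have := Int.mul_ediv_add_emod n Q
    omega
  have hlt : ∀ n : ℤ, (n % Q).toNat < Q := by
    intro n
    have := Int.emod_lt_of_pos n hQ0
    have := Int.emod_nonneg n hQ0.ne'
    omega
  have hsQ : ∃ ε : ℤ, s * h ^ (Q * (-l / Q)) = h ^ (Q * ε) * s := by
    have e2 : ∀ d : ℤ, ∃ ε : ℤ, s * h ^ (Q * d) * s⁻¹ = h ^ (Q * ε) := by
      intro d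
      have e3 : h ^ ((Q : ℤ) * d) = (h ^ N₀) ^ (N * d) := by
        rw [← zpow_natCast, ← zpow_mul, hQ]; push_cast; congr 1; ring
      rcases hconj s hsE with h1 | h1
      · exact ⟨d, by rw [e3, ← conj_zpow, h1]⟩
      · refine ⟨-d, ?_⟩
        have e4 : h ^ ((Q : ℤ) * -d) = (h ^ N₀)⁻¹ ^ (N * d) := by
          rw [← zpow_natCast, ← zpow_neg, ← zpow_mul, hQ]; push_cast; congr 1; ring
        rw [e3, e4, ← conj_zpow, h1]
    obtain ⟨ε, hε⟩ := e2 (-l / Q)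
    exact ⟨ε, by rw [← hε]; group⟩
  obtain ⟨ε, hε⟩ := hsQ
  refine ⟨h ^ (-k % Q).toNat * s * h ^ (-l % Q).toNat, ?_, N₀ * (-k / Q + ε), ?_⟩
  · refine Finset.mem_image.2 ⟨((s, (-k % Q).toNat), (-l % Q).toNat), ?_, rfl⟩
    simp only [Finset.mem_product, Finset.mem_range, Finite.mem_toFinset, mem_ofPred_eq]
    exact ⟨⟨hkl, hlt _⟩, hlt _⟩
  · have e5 : g = h ^ (-k) * s * h ^ (-l) := by rw [hs]; group
    have e6 : (N : ℤ) * (N₀ * (-k / Q + ε)) = Q * ε + Q * (-k / Q) := by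
      rw [hQ]; push_cast; ring
    rw [e6]
    conv_lhs => rw [e5, e1 (-k), e1 (-l)]
    have e7 : h ^ (-k % Q).toNat * (h ^ (Q * ε) * s) = h ^ (Q * ε) * h ^ (-k % Q).toNat * s := by
      rw [← mul_assoc]; congr 1
      rw [← zpow_natCast, ← zpow_add, ← zpow_add, add_comm]
    calc h ^ (Q * (-k / Q)) * h ^ (-k % Q).toNat * s * (h ^ (Q * (-l / Q)) * h ^ (-l % Q).toNat)
        = h ^ (Q * (-k / Q)) * (h ^ (-k % Q).toNat * (s * h ^ (Q * (-l / Q))))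
            * h ^ (-l % Q).toNat := by group
      _ = _ := by
        rw [hε, e7, ← add_comm, zpow_add]; group

/-- The stabilizer moves the base point within bounded distance of the axis. -/
lemma exists_dist_axis_le (ha : IsAxis o h π K c) :
    ∃ R : ℝ, 0 ≤ R ∧ ∀ g ∈ axisStabilizer h, ∃ k : ℤ, dist (g • o) (h ^ k • o) ≤ R := by
  obtain ⟨T, hT⟩ := ha.exists_finset_transversal one_pos
  refine ⟨∑ s ∈ T, dist (s • o) o, Finset.sum_nonneg fun _ _ => dist_nonneg, fun g hg => ?_⟩
  obtain ⟨s, hs, k, rfl⟩ := hT g hg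
  refine ⟨(1 : ℕ) * k, ?_⟩
  rw [mul_smul, dist_smul]
  exact Finset.single_le_sum (f := fun s => dist (s • o) o) (fun _ _ => dist_nonneg) hs

/-- The stabilizer is virtually cyclic, so finite index would make `G` elementary. -/
lemma not_finiteIndex (ha : IsAxis o h π K c) (hG : ¬ IsElementary G) :
    ¬ (axisStabilizer h).FiniteIndex := by
  classical
  intro hfi
  refine hG ⟨Subgroup.zpowers h, inferInstance, ?_⟩
  obtain ⟨T, hT⟩ := ha.exists_finset_transversal one_pos
  have hle : Subgroup.zpowers h ≤ axisStabilizer h := by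
    rintro _ ⟨k, rfl⟩; exact zpow_mem_axisStabilizer h k
  have hrel : ((Subgroup.zpowers h).subgroupOf (axisStabilizer h)).FiniteIndex := by
    set T' : Finset (axisStabilizer h) := T.subtype (· ∈ axisStabilizer h)
    refine Subgroup.finiteIndex_of_leftCoset_cover_const (s := T') (g := fun s => s⁻¹) ?_
    refine eq_univ_of_forall fun g => ?_
    obtain ⟨s, hs, k, e⟩ := hT _ (inv_mem g.2)
    have hsE : s ∈ axisStabilizer h := by
      have : s = (h ^ (((1 : ℕ) : ℤ) * k))⁻¹ * (g : G)⁻¹ := by rw [e]; group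
      rw [this]
      exact mul_mem (inv_mem (zpow_mem_axisStabilizer h _)) (inv_mem g.2)
    simp only [mem_iUnion]
    refine ⟨⟨s, hsE⟩, by simpa [T'] using hs, ?_⟩
    rw [mem_leftCoset_iff, inv_inv]
    refine Subgroup.mem_zpowers_iff.2 ⟨-((1 : ℕ) * k), ?_⟩
    have : (g : G) = (h ^ (((1 : ℕ) : ℤ) * k) * s)⁻¹ := by rw [← e, inv_inv]
    simp only [Subgroup.subtype_apply, Subgroup.coe_mul]
    rw [this]; group
  rw [Subgroup.finiteIndex_iff] at hrel hfi ⊢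
  have := Subgroup.relIndex_mul_index hle
  rw [← this]
  exact mul_ne_zero hrel hfi

end IsAxis

end Axis

/-! ### Conjugating `P` away from `E⁺(h)` -/

section Cover

variable {G X : Type*} [Group G] [MetricSpace X] [MulAction G X]

lemma EPlus_subset_axisStabilizer {h q : G} (hq : q ∈ EPlus h) : q ∈ axisStabilizer h := by
  obtain ⟨n, hn, e⟩ := hq
  exact ⟨n, n, hn, hn, e⟩

/-- An element whose centralizer has finite index lies in the elliptic radical. -/
lemma mem_ellipticRadical_of_finiteIndex {o : X} {p : G}
    (hp : (Subgroup.centralizer {p}).FiniteIndex) : p ∈ ellipticRadical G o := by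
  intro h _
  obtain ⟨n, hn, -, hmem⟩ := Subgroup.exists_pow_mem_of_index_ne_zero hp.index_ne_zero h
  refine ⟨n, by exact_mod_cast hn.ne', ?_⟩
  rw [Subgroup.mem_centralizer_singleton_iff] at hmem
  rw [zpow_natCast, mul_inv_eq_iff_eq_mul]
  exact hmem.symm

variable [IsIsometricSMul G X] [ProperSpace X] [ProperlyDiscontinuousSMul G X]
  {o : X} {h : G} {π : X → X} {K c : ℝ}

namespace IsAxis

-- Inverting `h ^ N` while commuting with a nonzero power of `h` would give `h` finite order.
omit [IsIsometricSMul G X] [ProperSpace X] [ProperlyDiscontinuousSMul G X] in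
lemma conj_pow_eq_of_mem_EPlus (ha : IsAxis o h π K c) {N : ℕ} (hN : 0 < N)
    (hN' : ∀ g ∈ axisStabilizer h, g * h ^ N * g⁻¹ = h ^ N ∨ g * h ^ N * g⁻¹ = (h ^ N)⁻¹)
    {q : G} (hq : q ∈ EPlus h) : q * h ^ N * q⁻¹ = h ^ N := by
  refine (hN' q (EPlus_subset_axisStabilizer hq)).resolve_right fun hinv => ?_
  obtain ⟨n, hn, e⟩ := hq
  have h1 : q * h ^ (n * N) * q⁻¹ = h ^ (n * N) := by
    rw [zpow_mul, ← conj_zpow, e]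
  have h2 : q * h ^ (n * N) * q⁻¹ = h ^ (-(n * N)) := by
    rw [mul_comm n, zpow_mul, zpow_natCast, ← conj_zpow, hinv, ← zpow_natCast, ← zpow_neg,
      ← zpow_mul]
    congr 1; ring
  have h3 := ha.zpow_injective (h1.symm.trans h2)
  have : n * N ≠ 0 := mul_ne_zero hn (by exact_mod_cast hN.ne')
  omega

lemma exists_pow_eq_zpow (ha : IsAxis o h π K c) {N : ℕ} (hN : 0 < N) {u : G}
    (hu : u ∈ axisStabilizer h) : ∃ e : ℤ, e ≠ 0 ∧ ∃ k : ℤ, u ^ e = h ^ (N * k) := by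
  obtain ⟨T, hT⟩ := ha.exists_finset_transversal hN
  have hex : ∀ i : ℕ, ∃ s : T, ∃ k : ℤ, u ^ i = h ^ (N * k) * s := fun i => by
    obtain ⟨s, hs, k, e⟩ := hT _ (pow_mem hu i)
    exact ⟨⟨s, hs⟩, k, e⟩
  choose s k hk using hex
  obtain ⟨i, j, hij, he⟩ := Finite.exists_ne_map_eq_of_infinite s
  refine ⟨(i : ℤ) - j, by omega, k i - k j, ?_⟩
  rw [zpow_sub, zpow_natCast, zpow_natCast, hk i, hk j, he]
  rw [mul_sub, zpow_sub]; group

/-- Two conjugators of `p` into the same coset of a central power of `h` differ by an element of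
the stabilizer or of the centralizer of `p`. -/
lemma mem_axisStabilizer_or_commute (ha : IsAxis o h π K c) {N : ℕ} (hN : 0 < N)
    {p s g₀ g : G} {a b : ℤ} (hu : g₀⁻¹ * p * g₀ = h ^ (N * a) * s)
    (hv : g⁻¹ * p * g = h ^ (N * b) * s) (hmem : g₀⁻¹ * p * g₀ ∈ axisStabilizer h)
    (hcomm : g₀⁻¹ * p * g₀ * h ^ N * (g₀⁻¹ * p * g₀)⁻¹ = h ^ N) :
    g₀⁻¹ * g ∈ axisStabilizer h ∨ g * g₀⁻¹ ∈ Subgroup.centralizer {p} := by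
  set u := g₀⁻¹ * p * g₀ with hu'
  set v := g⁻¹ * p * g with hv'
  have hN0 : (N : ℤ) ≠ 0 := by exact_mod_cast hN.ne'
  have hcz : ∀ k : ℤ, Commute (h ^ (N * k)) u := by
    intro k
    rw [zpow_mul, zpow_natCast]
    refine Commute.zpow_left ?_ k
    rw [mul_inv_eq_iff_eq_mul] at hcomm
    exact hcomm.symm
  have hvu : v = h ^ (N * (b - a)) * u := by
    rw [hv, hu, ← mul_assoc, ← zpow_add]; congr 2; ring
  obtain ⟨e, he, k, hk⟩ := ha.exists_pow_eq_zpow hN hmem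
  have hve : v ^ e = h ^ (N * ((b - a) * e + k)) := by
    rw [hvu, (hcz _).mul_zpow, hk, ← zpow_mul, ← zpow_add]; congr 1; ring
  -- Writing `p ^ e` in two ways shows that `g⁻¹ * g₀` commensurates `⟨h⟩`, unless `k = 0`. In that
  -- case both powers of `h` are trivial, which forces `a = b` and hence `u = v`.
  have hp1 : p ^ e = g₀ * h ^ (N * k) * g₀⁻¹ := by
    rw [← hk, ← conj_zpow, hu']; congr 1; group
  have hp2 : p ^ e = g * h ^ (N * ((b - a) * e + k)) * g⁻¹ := by
    rw [← hve, ← conj_zpow, hv']; congr 1; group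
  have hx : (g⁻¹ * g₀) * h ^ (N * k) * (g⁻¹ * g₀)⁻¹ = h ^ (N * ((b - a) * e + k)) := by
    have : g₀ * h ^ (N * k) * g₀⁻¹ = g * h ^ (N * ((b - a) * e + k)) * g⁻¹ := by rw [← hp1, hp2]
    calc (g⁻¹ * g₀) * h ^ (N * k) * (g⁻¹ * g₀)⁻¹ = g⁻¹ * (g₀ * h ^ (N * k) * g₀⁻¹) * g := by group
      _ = _ := by rw [this]; group
  by_cases hk0 : k = 0
  · right
    rw [hk0] at hx
    have h1 : h ^ ((N : ℤ) * ((b - a) * e + 0)) = 1 := by rw [← hx]; simp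
    have h2 := ha.zpow_eq_one h1
    have h3 : b - a = 0 := by
      have := (mul_eq_zero.1 h2).resolve_left hN0
      rw [add_zero] at this
      exact (mul_eq_zero.1 this).resolve_right he
    rw [h3] at hvu
    have h4 : v = u := by simpa using hvu
    rw [Subgroup.mem_centralizer_singleton_iff]
    rw [hv', hu'] at h4
    have h5 : p = g * (g⁻¹ * p * g) * g⁻¹ := by group
    rw [h4] at h5
    symm
    calc p * (g * g₀⁻¹) = (g * (g₀⁻¹ * p * g₀) * g⁻¹) * (g * g₀⁻¹) := by rw [← h5]
      _ = _ := by group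
  · left
    have hl : (b - a) * e + k ≠ 0 := by
      intro h0
      rw [h0, mul_zero, zpow_zero, mul_inv_eq_one] at hx
      have := ha.zpow_eq_one (mul_eq_left.1 hx)
      exact (mul_ne_zero hN0 hk0) this
    have := inv_mem (show g⁻¹ * g₀ ∈ axisStabilizer h from
      ⟨_, _, mul_ne_zero hN0 hk0, mul_ne_zero hN0 hl, hx⟩)
    simpa using this

/-- Some conjugate of `P` avoids `E⁺(h)`, with conjugator outside given cosets of the stabilizer. -/
lemma exists_conj_notMem_EPlus (ha : IsAxis o h π K c) (hG : ¬ IsElementary G) (P : Finset G)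
    (hP : Disjoint (P : Set G) (ellipticRadical G o)) (F : Finset G) :
    ∃ g : G, (∀ p ∈ P, g⁻¹ * p * g ∉ EPlus h) ∧ ∀ f ∈ F, f⁻¹ * g ∉ axisStabilizer h := by
  classical
  by_contra hcon
  push Not at hcon
  obtain ⟨N, hN, hN'⟩ := ha.exists_uniform_pow
  obtain ⟨T, hT⟩ := ha.exists_finset_transversal hN
  -- For each `p ∈ P` and transversal element, all bad conjugators lie in one left coset of the
  -- stabilizer or one right coset of the centralizer of `p`.
  have hrep : ∀ x : G × G, ∃ g₀ : G, ∀ g : G, g⁻¹ * x.1 * g ∈ EPlus h →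
      (∃ k : ℤ, g⁻¹ * x.1 * g = h ^ (N * k) * x.2) →
      g₀⁻¹ * g ∈ axisStabilizer h ∨ g * g₀⁻¹ ∈ Subgroup.centralizer {x.1} := by
    intro x
    by_cases hx : ∃ g₀ : G, g₀⁻¹ * x.1 * g₀ ∈ EPlus h ∧
        ∃ k : ℤ, g₀⁻¹ * x.1 * g₀ = h ^ (N * k) * x.2
    · obtain ⟨g₀, h1, a, h2⟩ := hx
      refine ⟨g₀, fun g _ ⟨b, hb⟩ => ?_⟩
      exact ha.mem_axisStabilizer_or_commute hN h2 hb (EPlus_subset_axisStabilizer h1)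
        (ha.conj_pow_eq_of_mem_EPlus hN hN' h1)
    · exact ⟨1, fun g h1 h2 => absurd ⟨g, h1, h2⟩ hx⟩
  choose r hr using hrep
  let γ : G ⊕ (G × G) ⊕ (G × G) → G := Sum.elim id (Sum.elim r r)
  let Hs : G ⊕ (G × G) ⊕ (G × G) → Subgroup G := Sum.elim (fun _ => axisStabilizer h)
    (Sum.elim (fun _ => axisStabilizer h)
      (fun x => (Subgroup.centralizer {x.1}).comap (MulAut.conj (r x)).toMonoidHom))
  -- Without a good conjugator these cosets and those from `F` cover `G`; right cosets of the
  -- centralizer count as left cosets of its conjugates. By Neumann's lemma one of the subgroups has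
  -- finite index.
  obtain ⟨k, hk, hfi⟩ := Subgroup.exists_finiteIndex_of_leftCoset_cover
    (s := F.disjSum ((P ×ˢ T).disjSum (P ×ˢ T))) (g := γ) (H := Hs) (by
      refine eq_univ_of_forall fun g => ?_
      simp only [mem_iUnion]
      by_cases hg : ∀ p ∈ P, g⁻¹ * p * g ∉ EPlus h
      · obtain ⟨f, hf, hf'⟩ := hcon g hg
        exact ⟨Sum.inl f, by simpa using hf, by simpa [γ, Hs, mem_leftCoset_iff] using hf'⟩
      · push Not at hg
        obtain ⟨p, hp, hg⟩ := hg
        obtain ⟨s, hs, k, e⟩ := hT _ (EPlus_subset_axisStabilizer hg)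
        rcases hr (p, s) g hg ⟨k, e⟩ with h1 | h1
        · exact ⟨Sum.inr (Sum.inl (p, s)), by simp [hp, hs],
            by simpa [γ, Hs, mem_leftCoset_iff] using h1⟩
        · refine ⟨Sum.inr (Sum.inr (p, s)), by simp [hp, hs], ?_⟩
          rw [mem_leftCoset_iff]
          simpa [γ, Hs] using h1)
  have hnot := ha.not_finiteIndex hG
  rcases k with f | x | x
  · exact hnot hfi
  · exact hnot hfi
  · have hx : x.1 ∈ P := by
      have : x.1 ∈ P ∧ x.2 ∈ T := by simpa using hk
      exact this.1
    refine Set.disjoint_left.1 hP hx (mem_ellipticRadical_of_finiteIndex ?_)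
    rw [Subgroup.finiteIndex_iff] at hfi ⊢
    have := Subgroup.index_comap_of_surjective (Subgroup.centralizer {x.1})
      (f := (MulAut.conj (r x)).toMonoidHom) (MulAut.conj (r x)).surjective
    rwa [← this]

lemma exists_three_conj (ha : IsAxis o h π K c) (hG : ¬ IsElementary G) (P : Finset G)
    (hP : Disjoint (P : Set G) (ellipticRadical G o)) :
    ∃ e : Fin 3 → G, (∀ k, ∀ p ∈ P, (e k)⁻¹ * p * e k ∉ EPlus h) ∧
      ∀ k l, k ≠ l → (e k)⁻¹ * e l ∉ axisStabilizer h := by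
  classical
  obtain ⟨g₀, h0, -⟩ := ha.exists_conj_notMem_EPlus hG P hP ∅
  obtain ⟨g₁, h1, h1'⟩ := ha.exists_conj_notMem_EPlus hG P hP {g₀}
  obtain ⟨g₂, h2, h2'⟩ := ha.exists_conj_notMem_EPlus hG P hP {g₀, g₁}
  have a01 : g₀⁻¹ * g₁ ∉ axisStabilizer h := h1' g₀ (by simp)
  have a02 : g₀⁻¹ * g₂ ∉ axisStabilizer h := h2' g₀ (by simp)
  have a12 : g₁⁻¹ * g₂ ∉ axisStabilizer h := h2' g₁ (by simp)
  have hsymm : ∀ {x y : G}, x⁻¹ * y ∉ axisStabilizer h → y⁻¹ * x ∉ axisStabilizer h := by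
    intro x y hxy hyx
    exact hxy (by simpa using inv_mem hyx)
  refine ⟨![g₀, g₁, g₂], fun k => ?_, fun k l hkl => ?_⟩
  · fin_cases k
    exacts [h0, h1, h2]
  · fin_cases k <;> fin_cases l <;> first | exact absurd rfl hkl | skip
    exacts [a01, a02, hsymm a01, a12, hsymm a02, hsymm a12]

end IsAxis

end Cover

/-! ### Moving far along an axis -/

section Insertion

variable {G X : Type*} [Group G] [MetricSpace X] [MulAction G X]

/-- The distance between the projections of two points to the translate by `g` of the axis. -/
def axisDist (π : X → X) (g : G) (x y : X) : ℝ := dist (π (g⁻¹ • x)) (π (g⁻¹ • y))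

lemma axisDist_comm (π : X → X) (g : G) (x y : X) : axisDist π g x y = axisDist π g y x :=
  dist_comm _ _

lemma axisDist_triangle (π : X → X) (g : G) (x y z : X) :
    axisDist π g x z ≤ axisDist π g x y + axisDist π g y z := dist_triangle _ _ _

lemma axisDist_mul (π : X → X) (z g : G) (x y : X) :
    axisDist π (z * g) x y = axisDist π g (z⁻¹ • x) (z⁻¹ • y) := by
  simp only [axisDist, mul_inv_rev, mul_smul]

variable [IsIsometricSMul G X] {o : X} {h : G} {π : X → X} {K c : ℝ}

namespace IsAxis

lemma axisDist_le (ha : IsAxis o h π K c) (g : G) (x y : X) :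
    axisDist π g x y ≤ dist x y + K := by
  have := ha.proj.dist_proj_proj_le (g⁻¹ • x) (g⁻¹ • y)
  rwa [dist_smul] at this

lemma axisDist_mono (ha : IsAxis o h π K c) (g : G) {s a b : X} {ε : ℝ} (hε : 0 ≤ ε)
    (hs : dist s a + dist a b ≤ dist s b + ε) :
    axisDist π g s a ≤ axisDist π g s b + 2 * K + ε :=
  ha.proj.dist_proj_mono hε (by simpa only [dist_smul] using hs)

lemma dist_proj_zpow_smul_le (ha : IsAxis o h π K c) (k : ℤ) (x : X) :
    dist (π (h ^ k • x)) (h ^ k • π x) ≤ K := by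
  obtain ⟨i, hi⟩ := ha.exists_proj_eq x
  obtain ⟨j, hj⟩ := ha.exists_proj_eq (h ^ k • x)
  have h1 := ha.proj.le x (h ^ (-k + j) • o) ⟨_, rfl⟩
  have h2 : dist (h ^ k • x) (π (h ^ k • x)) = dist x (h ^ (-k + j) • o) := by
    rw [← hj, ← dist_smul (h ^ k) x, ← mul_smul, ← zpow_add, add_neg_cancel_left]
  have h3 := ha.proj.dist_proj_le_of_near (x := h ^ k • x) (z := h ^ k • π x) le_rfl
    ⟨k + i, by rw [← hi]; simp only [zpow_add, mul_smul]⟩ (by rw [dist_smul, h2]; linarith)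
  linarith

variable [ProperSpace X] [ProperlyDiscontinuousSMul G X]

/-- Behrstock's inequality for translates of the axis that are not coarsely equal. -/
lemma exists_behrstock (ha : IsAxis o h π K c) (hX : IsGeodesicSpace X) :
    ∃ κ : ℝ, 0 ≤ κ ∧ ∀ g g' : G, g⁻¹ * g' ∉ axisStabilizer h → ∀ x : X,
      axisDist π g x (g' • o) ≤ κ ∨ axisDist π g' x (g • o) ≤ κ := by
  have hK := ha.K_nonneg
  obtain ⟨B, hB, hB'⟩ := ha.exists_proj_bound hX
  refine ⟨2 * K + B, by positivity, fun g g' hg x => ?_⟩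
  set f := g⁻¹ * g' with hf
  set y := g⁻¹ • x with hy
  have hf' : f⁻¹ ∉ axisStabilizer h := fun h' => hg (by simpa using inv_mem h')
  have e1 : g'⁻¹ • x = f⁻¹ • y := by rw [hf, hy, ← mul_smul]; congr 1; group
  have e2 : g⁻¹ • g' • o = f • o := by rw [hf, mul_smul]
  have e3 : g'⁻¹ • g • o = f⁻¹ • o := by rw [hf, ← mul_smul]; congr 1; group
  simp only [axisDist, e1, e2, e3]
  rw [← hy]
  rcases ha.proj.behrstock (ha.proj.smul f) y with h1 | h1
  · left
    obtain ⟨i, hi⟩ := ha.exists_proj_eq (f⁻¹ • y)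
    simp only [← hi] at h1
    have h2 := hB' f hg i 0
    rw [zpow_zero, one_smul] at h2
    have := dist_triangle (π y) (π (f • h ^ i • o)) (π (f • o))
    linarith
  · right
    simp only [dist_smul] at h1
    obtain ⟨i, hi⟩ := ha.exists_proj_eq y
    rw [← hi] at h1
    have h2 := hB' f⁻¹ hf' i 0
    rw [zpow_zero, one_smul] at h2
    have := dist_triangle (π (f⁻¹ • y)) (π (f⁻¹ • h ^ i • o)) (π (f⁻¹ • o))
    linarith

omit [IsIsometricSMul G X] [ProperSpace X] [ProperlyDiscontinuousSMul G X] in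
lemma tendsto_dist_pow (ha : IsAxis o h π K c) {N : ℕ} (hN : 0 < N) :
    Tendsto (fun n : ℕ => dist o (h ^ (N * n) • o)) atTop atTop := by
  have h1 : Function.Injective fun n : ℕ => ((N * n : ℕ) : ℤ) := fun a b hab =>
    Nat.eq_of_mul_eq_mul_left hN (Nat.cast_injective (R := ℤ) hab)
  have h2 := ha.tendsto_dist.comp h1.tendsto_cofinite
  rw [Nat.cofinite_eq_atTop] at h2
  exact h2.congr fun n => by simp only [Function.comp, zpow_natCast]

/-- Conjugating `q ∉ E⁺(h)` by a large power of `h` gives an element that moves points with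
projection close to `o` to points with projection far from `o`. -/
lemma eventually_lt_dist_proj (ha : IsAxis o h π K c) (hX : IsGeodesicSpace X) {N : ℕ}
    (hN : 0 < N)
    (hN' : ∀ g ∈ axisStabilizer h, g * h ^ N * g⁻¹ = h ^ N ∨ g * h ^ N * g⁻¹ = (h ^ N)⁻¹)
    {q : G} (hq : q ∉ EPlus h) (ρ Λ : ℝ) :
    ∀ᶠ n : ℕ in atTop, ∀ v : X, dist o (π v) ≤ ρ →
      Λ < dist o (π (h ^ (N * n) • q • (h ^ (N * n))⁻¹ • v)) := by
  have hK := ha.K_nonneg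
  -- Translating by a power of `h` moves the large conjugation into the base point, leaving the
  -- action of `q` itself on points projecting near `h ^ (-N * n) o`.
  have main : ∀ Λ' : ℝ, ∀ᶠ n : ℕ in atTop, ∀ u : X, dist ((h ^ (N * n))⁻¹ • o) (π u) ≤ ρ + K →
      Λ' < dist ((h ^ (N * n))⁻¹ • o) (π (q • u)) := by
    intro Λ'
    -- If `q` preserves the axis coarsely then, not being in `E⁺(h)`, it inverts `h ^ N`, and so
    -- moves points near one end of the axis to the opposite end.
    by_cases hqE : q ∈ axisStabilizer h
    · obtain ⟨R, hR, hR'⟩ := ha.exists_dist_axis_le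
      have hflip : q * h ^ N * q⁻¹ = (h ^ N)⁻¹ := (hN' q hqE).resolve_left fun h1 =>
        hq ⟨N, by exact_mod_cast hN.ne', by rw [zpow_natCast]; exact h1⟩
      filter_upwards [(ha.tendsto_dist_pow (N := 2 * N) (by omega)).eventually_gt_atTop
        (Λ' + (K + 3 * R) + (ρ + K) + dist o (q • o))] with n hn u hu
      have h1 := ha.proj.dist_proj_le_of_hausdorff (ha.proj.smul q) (R := R)
        (by
          rintro _ ⟨k, rfl⟩
          obtain ⟨j, hj⟩ := hR' _ (mul_mem (inv_mem hqE) (zpow_mem_axisStabilizer h k))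
          refine ⟨_, ⟨_, ⟨j, rfl⟩, rfl⟩, ?_⟩
          rw [mul_smul, ← dist_smul q, smul_inv_smul] at hj
          exact hj)
        (by
          rintro _ ⟨_, ⟨k, rfl⟩, rfl⟩
          obtain ⟨j, hj⟩ := hR' _ (mul_mem hqE (zpow_mem_axisStabilizer h k))
          refine ⟨_, ⟨j, rfl⟩, ?_⟩
          rw [mul_smul] at hj
          exact hj) (q • u)
      simp only [inv_smul_smul] at h1
      set z := h ^ (N * n) with hz
      have hqz : q * z⁻¹ = z * q := by
        have : q * z * q⁻¹ = z⁻¹ := by rw [hz, pow_mul, ← conj_pow, hflip, inv_pow]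
        have h2 : q * z⁻¹ * q⁻¹ = z := by rw [← conj_inv, this, inv_inv]
        calc q * z⁻¹ = q * z⁻¹ * q⁻¹ * q := by group
          _ = z * q := by rw [h2]
      have h2 : dist (z • q • o) (q • π u) ≤ ρ + K := by
        rw [← mul_smul, ← hqz, mul_smul, dist_smul]; exact hu
      have h3 : dist (z⁻¹ • o) (z • o) = dist o (h ^ (2 * N * n) • o) := by
        rw [← dist_smul z, smul_inv_smul, ← mul_smul, hz, ← pow_add]
        congr 3; ring
      have h4 : dist (z • o) (z • q • o) = dist o (q • o) := dist_smul _ _ _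
      have h5 := dist_triangle4 (z⁻¹ • o) (π (q • u)) (q • π u) (z • q • o)
      have h6 := dist_triangle_right (z⁻¹ • o) (z • o) (z • q • o)
      rw [dist_comm (q • π u)] at h5
      linarith
    · obtain ⟨κ, hκ, hκ'⟩ := ha.exists_behrstock hX
      filter_upwards [(ha.tendsto_dist_pow hN).eventually_gt_atTop (Λ' + dist o (π (q • o)) + κ),
        (ha.tendsto_dist_pow hN).eventually_gt_atTop (ρ + K + κ + dist (π (q⁻¹ • o)) o)]
        with n hn hn' u hu
      set z := h ^ (N * n)
      have hz : dist o (z • o) = dist (z⁻¹ • o) o := by rw [← dist_smul z (z⁻¹ • o), smul_inv_smul]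
      rw [hz] at hn hn'
      -- If `q` moves the axis away, `q u` projects near the fixed point `π (q o)`: the other
      -- alternative confines `π u` near `π (q⁻¹ o)`, too far from where it is.
      have := hκ' 1 q (by simpa using hqE) (q • u)
      simp only [axisDist, inv_one, one_smul, inv_smul_smul] at this
      rcases this with h1 | h1
      · have h2 := dist_triangle4 (z⁻¹ • o) (π (q • u)) (π (q • o)) o
        rw [dist_comm (π (q • o)) o] at h2
        linarith
      · have h2 := dist_triangle4 (z⁻¹ • o) (π u) (π (q⁻¹ • o)) o
        linarith
  filter_upwards [main (Λ + K)] with n hn v hv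
  set z := h ^ (N * n) with hz
  have hzz : z = h ^ ((N * n : ℕ) : ℤ) := by rw [zpow_natCast]
  have hzi : z⁻¹ = h ^ (-((N * n : ℕ) : ℤ)) := by rw [zpow_neg, zpow_natCast]
  have h1 : dist (z⁻¹ • o) (π (z⁻¹ • v)) ≤ ρ + K := by
    have h2 := ha.dist_proj_zpow_smul_le (-((N * n : ℕ) : ℤ)) v
    rw [← hzi, dist_comm] at h2
    have h3 := dist_triangle (z⁻¹ • o) (z⁻¹ • π v) (π (z⁻¹ • v))
    rw [dist_smul] at h3
    linarith
  have h2 := hn _ h1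
  have h3 := ha.dist_proj_zpow_smul_le ((N * n : ℕ) : ℤ) (q • z⁻¹ • v)
  rw [← hzz] at h3
  have h4 := dist_triangle o (π (z • q • z⁻¹ • v)) (z • π (q • z⁻¹ • v))
  rw [← dist_smul z, smul_inv_smul] at h2
  linarith

/-- Among three independent translates of the axis there is one on which two given points project
close to the base point. -/
lemma exists_axisDist_le (ha : IsAxis o h π K c) (hX : IsGeodesicSpace X) {e : Fin 3 → G}
    (he : ∀ k l, k ≠ l → (e k)⁻¹ * e l ∉ axisStabilizer h) :
    ∃ κ : ℝ, 0 ≤ κ ∧ ∀ t u : X, ∃ k, axisDist π (e k) o t ≤ κ ∧ axisDist π (e k) o u ≤ κ := by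
  have hK := ha.K_nonneg
  obtain ⟨κ, hκ, hκ'⟩ := ha.exists_behrstock hX
  set R := ∑ k, dist o (e k • o) with hR
  have hR0 : 0 ≤ R := Finset.sum_nonneg fun _ _ => dist_nonneg
  have hRk : ∀ k, dist o (e k • o) ≤ R := fun k =>
    Finset.single_le_sum (f := fun k => dist o (e k • o)) (fun _ _ => dist_nonneg)
      (Finset.mem_univ k)
  refine ⟨κ + R + K, by positivity, ?_⟩
  have hone : ∀ (t : X) (k l), k ≠ l →
      axisDist π (e k) o t ≤ κ + R + K ∨ axisDist π (e l) o t ≤ κ + R + K := by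
    intro t k l hkl
    have aux : ∀ k l, axisDist π (e k) t (e l • o) ≤ κ → axisDist π (e k) o t ≤ κ + R + K := by
      intro k l hl
      have h1 := axisDist_triangle π (e k) o (e l • o) t
      have h2 := ha.axisDist_le (e k) o (e l • o)
      rw [axisDist_comm π (e k) (e l • o) t] at h1
      linarith [hRk l]
    exact (hκ' (e k) (e l) (he k l hkl) t).imp (aux k l) (aux l k)
  intro t u
  by_contra hcon
  push Not at hcon
  -- Each of the two points can be bad for at most one of the three axes.
  have t01 := hone t 0 1 (by decide)
  have t02 := hone t 0 2 (by decide)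
  have t12 := hone t 1 2 (by decide)
  have u01 := hone u 0 1 (by decide)
  have u02 := hone u 0 2 (by decide)
  have u12 := hone u 1 2 (by decide)
  have c0 := hcon 0
  have c1 := hcon 1
  have c2 := hcon 2
  simp only [← not_le] at c0 c1 c2
  tauto

/-- Conjugators that turn all elements of `P` into elements moving far along the given axes. -/
lemma exists_conjugators (ha : IsAxis o h π K c) (hX : IsGeodesicSpace X) {e : Fin 3 → G}
    {P : Finset G} (he : ∀ k, ∀ p ∈ P, (e k)⁻¹ * p * e k ∉ EPlus h) (ρ Λ : ℝ) :
    ∃ β : Fin 3 → G, ∀ k, ∀ p ∈ P, ∀ v : X, axisDist π (e k) o v ≤ ρ →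
      Λ < axisDist π (e k) o ((β k * p * (β k)⁻¹) • v) := by
  obtain ⟨N, hN, hN'⟩ := ha.exists_uniform_pow
  have hex : ∀ k, ∃ b : G, ∀ p ∈ P, ∀ v : X, axisDist π (e k) o v ≤ ρ →
      Λ < axisDist π (e k) o ((b * p * b⁻¹) • v) := by
    intro k
    set R := dist o (π ((e k)⁻¹ • o)) with hR
    have h1 : ∀ᶠ n : ℕ in atTop, ∀ p ∈ P, ∀ v : X, dist o (π v) ≤ ρ + R →
        Λ + R < dist o (π (h ^ (N * n) • ((e k)⁻¹ * p * e k) • (h ^ (N * n))⁻¹ • v)) := by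
      rw [Filter.eventually_all_finset]
      intro p hp
      exact ha.eventually_lt_dist_proj hX hN hN' (he k p hp) _ _
    obtain ⟨n, hn⟩ := h1.exists
    set z := h ^ (N * n)
    refine ⟨e k * z * (e k)⁻¹, fun p hp v hv => ?_⟩
    simp only [axisDist] at hv ⊢
    have h2 := dist_triangle o (π ((e k)⁻¹ • o)) (π ((e k)⁻¹ • v))
    have h3 := hn p hp ((e k)⁻¹ • v) (by linarith)
    have e1 : (e k)⁻¹ • (e k * z * (e k)⁻¹ * p * (e k * z * (e k)⁻¹)⁻¹) • v =
        z • ((e k)⁻¹ * p * e k) • z⁻¹ • (e k)⁻¹ • v := by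
      simp only [← mul_smul]; congr 1; group
    rw [e1]
    have h4 := dist_triangle o (π ((e k)⁻¹ • o))
      (π (z • ((e k)⁻¹ * p * e k) • z⁻¹ • (e k)⁻¹ • v))
    linarith
  choose β hβ using hex
  exact ⟨β, hβ⟩

end IsAxis

end Insertion

/-! ### Products with insertions and ping-pong -/

section InsertionProd

variable {G X : Type*} [Group G] [MetricSpace X] [MulAction G X]

/-- The element obtained from `g` by inserting `w i` behind `a i`, for all `i` in the list. -/
def insertionProd (a w : ℕ → G) (g : G) : List ℕ → G
  | [] => g
  | i :: I => a i * w i * (a i)⁻¹ * insertionProd a w g I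

lemma exists_mem_insertionProd_eq {H : Subgroup G} {a w : ℕ → G} {m : ℕ}
    (hw : ∀ i ≤ m, a i * w i * (a i)⁻¹ ∈ H) (g : G) (I : List ℕ) (hI : ∀ i ∈ I, i ≤ m) :
    ∃ x ∈ H, insertionProd a w g I = x * g := by
  induction I with
  | nil => exact ⟨1, one_mem _, by simp [insertionProd]⟩
  | cons i I ih =>
    obtain ⟨x, hx, e⟩ := ih fun j hj => hI j (List.mem_cons_of_mem _ hj)
    exact ⟨_, mul_mem (hw i (hI i List.mem_cons_self)) hx, by
      rw [insertionProd, e]; simp only [mul_assoc]⟩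

variable [IsIsometricSMul G X] {o : X}

lemma dist_insertionProd_le {a w : ℕ → G} {m : ℕ} {T : ℕ → ℝ} {E W : ℝ} (hE : 0 ≤ E) (hW : 0 ≤ W)
    (hT : ∀ i j, i < j → j ≤ m → dist (a i • o) (a j • o) ≤ T j - T i + E)
    (hw : ∀ i ≤ m, dist o (w i • o) ≤ W) (I : List ℕ) :
    ∀ i ≤ m, (i :: I).Pairwise (· < ·) → (∀ j ∈ I, j ≤ m) →
      dist (a i • o) (insertionProd a w (a m) I • o) ≤ T m - T i + (I.length + 1) * (E + W) := by
  induction I with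
  | nil =>
    intro i hi _ _
    rcases hi.eq_or_lt with rfl | hlt
    · simp [insertionProd]; linarith
    · have := hT i m hlt le_rfl
      simp [insertionProd]; linarith
  | cons j I ih =>
    intro i hi hp hle
    have hj : j ≤ m := hle j List.mem_cons_self
    have hij : i < j := List.rel_of_pairwise_cons hp List.mem_cons_self
    have h1 := ih j hj hp.of_cons fun l hl => hle l (List.mem_cons_of_mem _ hl)
    have h2 := hT i j hij hj
    have h3 := dist_triangle4 (a i • o) (a j • o) (a j • w j • o)
      (a j • w j • (a j)⁻¹ • insertionProd a w (a m) I • o)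
    rw [dist_smul, dist_smul, dist_smul, ← dist_smul (a j) o ((a j)⁻¹ • _), smul_inv_smul] at h3
    have h4 := hw j hj
    have e1 : insertionProd a w (a m) (j :: I) • o =
        a j • w j • (a j)⁻¹ • insertionProd a w (a m) I • o := by
      simp only [insertionProd, mul_smul]
    rw [e1, List.length_cons]
    push_cast
    linarith

variable {h : G} {π : X → X} {K c : ℝ}

/-- A sequence of group elements along which elements `w i` that move far along the axis translated
by `b i` can be inserted independently. -/
structure IsInsertable (o : X) (h : G) (π : X → X) (κ R Λ : ℝ) (m : ℕ) (a b w : ℕ → G) :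
    Prop where
  base : ∀ i ≤ m, dist o (b i • o) ≤ R
  proj_le : ∀ i ≤ m, ∀ j ≤ m, axisDist π (b i) o ((a i)⁻¹ • a j • o) ≤ κ
  indep : ∀ i j, i < j → j ≤ m → (b i)⁻¹ * ((a i)⁻¹ * a j * b j) ∉ axisStabilizer h
  lt_proj : ∀ i ≤ m, ∀ v, axisDist π (b i) o v ≤ Λ → Λ < axisDist π (b i) o (w i • v)

namespace IsInsertable

variable {κ κ' R Λ : ℝ} {m : ℕ} {a b w : ℕ → G}

/-- By induction on the later insertions. The next one, at `j`, throws the tail far along the axis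
at `j`, so by Behrstock's inequality the tail projects to the axis at `i` near `a j o`, which
projects near the base point. -/
lemma axisDist_insertionProd_le (hi : IsInsertable o h π κ R Λ m a b w) (ha : IsAxis o h π K c)
    (hκ' : 0 ≤ κ') (hR : 0 ≤ R) (hΛ : Λ = κ' + R + K + κ)
    (hB : ∀ g g' : G, g⁻¹ * g' ∉ axisStabilizer h → ∀ x : X,
      axisDist π g x (g' • o) ≤ κ' ∨ axisDist π g' x (g • o) ≤ κ') (I : List ℕ) :
    ∀ i ≤ m, (i :: I).Pairwise (· < ·) → (∀ j ∈ I, j ≤ m) →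
      axisDist π (b i) o ((a i)⁻¹ • insertionProd a w (a m) I • o) ≤ Λ := by
  have hK := ha.K_nonneg
  induction I with
  | nil =>
    intro i him _ _
    have := hi.proj_le i him m le_rfl
    simp only [insertionProd]
    linarith
  | cons j I ih =>
    intro i him hp hle
    have hj : j ≤ m := hle j List.mem_cons_self
    have hij : i < j := List.rel_of_pairwise_cons hp List.mem_cons_self
    have h1 := hi.lt_proj j hj _ (ih j hj hp.of_cons fun l hl => hle l (List.mem_cons_of_mem _ hl))
    set u := (a j)⁻¹ • insertionProd a w (a m) I • o with hu
    set z := (a i)⁻¹ * a j with hz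
    have e1 : (a i)⁻¹ • insertionProd a w (a m) (j :: I) • o = z • w j • u := by
      simp only [insertionProd, hz, hu, mul_smul]
    rw [e1]
    set t := z • w j • u with ht
    have h2 := hi.proj_le i him j hj
    rw [← mul_smul, ← hz] at h2
    rcases hB (b i) (z * b j) (hi.indep i j hij hj) t with h3 | h3
    · have h4 := ha.axisDist_le (b i) ((z * b j) • o) (z • o)
      rw [mul_smul, dist_smul, dist_comm] at h4
      have h5 := hi.base j hj
      rw [mul_smul] at h3
      have h6 := axisDist_triangle π (b i) t (z • b j • o) (z • o)
      have h7 := axisDist_triangle π (b i) o (z • o) t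
      rw [axisDist_comm π (b i) (z • o)] at h7
      linarith
    -- Here the tail would project to the axis at `j` within `κ' + R + K + κ = Λ` of the base point,
    -- contrary to `lt_proj`.
    · exfalso
      rw [axisDist_mul, ht, inv_smul_smul] at h3
      have h4 := ha.axisDist_le (b j) (z⁻¹ • b i • o) (z⁻¹ • o)
      rw [dist_smul, dist_comm] at h4
      have h5 := hi.base i him
      have h6 := hi.proj_le j hj i him
      have e2 : (a j)⁻¹ • a i • o = z⁻¹ • o := by
        rw [← mul_smul, hz, mul_inv_rev, inv_inv]
      rw [e2] at h6
      have h7 := axisDist_triangle π (b j) (w j • u) (z⁻¹ • b i • o) (z⁻¹ • o)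
      have h8 := axisDist_triangle π (b j) o (z⁻¹ • o) (w j • u)
      rw [axisDist_comm π (b j) (z⁻¹ • o)] at h8
      linarith

/-- At the first position in just one of the two lists, the projection distance from the base point
exceeds `Λ` for the product with the insertion, and is at most `Λ` for the other. -/
lemma insertionProd_injective (hi : IsInsertable o h π κ R Λ m a b w) (ha : IsAxis o h π K c)
    (hκ' : 0 ≤ κ') (hR : 0 ≤ R) (hΛ : Λ = κ' + R + K + κ)
    (hB : ∀ g g' : G, g⁻¹ * g' ∉ axisStabilizer h → ∀ x : X,
      axisDist π g x (g' • o) ≤ κ' ∨ axisDist π g' x (g • o) ≤ κ') (I : List ℕ) :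
    ∀ J : List ℕ, I.Pairwise (· < ·) → J.Pairwise (· < ·) → (∀ j ∈ I, j ≤ m) → (∀ j ∈ J, j ≤ m) →
      insertionProd a w (a m) I = insertionProd a w (a m) J → I = J := by
  have key : ∀ (i : ℕ) (I J : List ℕ), (i :: I).Pairwise (· < ·) → (i :: J).Pairwise (· < ·) →
      (∀ j ∈ i :: I, j ≤ m) → (∀ j ∈ J, j ≤ m) →
      insertionProd a w (a m) (i :: I) ≠ insertionProd a w (a m) J := by
    intro i I J hI hJ hIm hJm e
    have him := hIm i List.mem_cons_self
    have h1 := hi.axisDist_insertionProd_le ha hκ' hR hΛ hB J i him hJ hJm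
    have h2 := hi.lt_proj i him _ (hi.axisDist_insertionProd_le ha hκ' hR hΛ hB I i him hI
      fun j hj => hIm j (List.mem_cons_of_mem _ hj))
    rw [← e] at h1
    simp only [insertionProd, mul_smul, inv_smul_smul] at h1
    linarith
  induction I with
  | nil =>
    intro J _ hJ _ hJm e
    cases J with
    | nil => rfl
    | cons j J => exact absurd e.symm (key j J [] hJ (by simp) hJm (by simp))
  | cons i I ih =>
    intro J hI hJ hIm hJm e
    cases J with
    | nil => exact absurd e (key i I [] hI (by simp) hIm (by simp))
    | cons j J =>
      have hext : ∀ {i j : ℕ} {J : List ℕ}, i < j → (j :: J).Pairwise (· < ·) →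
          (i :: j :: J).Pairwise (· < ·) := by
        intro i j J hij hJ
        refine List.pairwise_cons.2 ⟨fun l hl => ?_, hJ⟩
        rcases List.mem_cons.1 hl with rfl | hl
        · exact hij
        · exact hij.trans (List.rel_of_pairwise_cons hJ hl)
      rcases lt_trichotomy i j with hij | rfl | hij
      · exact absurd e (key i I _ hI (hext hij hJ) hIm hJm)
      · congr 1
        refine ih J hI.of_cons hJ.of_cons (fun l hl => hIm l (List.mem_cons_of_mem _ hl))
          (fun l hl => hJm l (List.mem_cons_of_mem _ hl)) ?_
        simpa [insertionProd] using e
      · exact absurd e.symm (key j J _ hJ (hext hij hI) hJm hIm)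

end IsInsertable

/-- Inserting conjugates of elements of `P` along a sequence of orbit points that project close to
the base point of one of three axes: different choices of positions yield different elements, and
each insertion costs a bounded length. -/
lemma IsAxis.exists_insertion [ProperSpace X] [ProperlyDiscontinuousSMul G X]
    (ha : IsAxis o h π K c) (hX : IsGeodesicSpace X) {e : Fin 3 → G} {P : Finset G}
    (he : ∀ k, ∀ p ∈ P, (e k)⁻¹ * p * e k ∉ EPlus h) {κ : ℝ} (hκ : 0 ≤ κ) :
    ∃ L > 0, ∃ D ≥ 0, ∃ β : Fin 3 → G, ∀ (m : ℕ) (a : ℕ → G) (k : ℕ → Fin 3) (p : ℕ → G),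
      (∀ i ≤ m, p i ∈ P) →
      (∀ i ≤ m, ∀ j ≤ m, axisDist π (e (k i)) o ((a i)⁻¹ • a j • o) ≤ κ) →
      (∀ i j, i < j → j ≤ m → L ≤ dist (a i • o) (a j • o)) →
      (∀ I ⊆ Finset.Icc 1 m, ∀ J ⊆ Finset.Icc 1 m,
        insertionProd a (fun i => β (k i) * p i * (β (k i))⁻¹) (a m) (I.sort (· ≤ ·)) =
        insertionProd a (fun i => β (k i) * p i * (β (k i))⁻¹) (a m) (J.sort (· ≤ ·)) → I = J) ∧
      ∀ (T : ℕ → ℝ) (E : ℝ), 0 ≤ E →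
        (∀ i j, i < j → j ≤ m → dist (a i • o) (a j • o) ≤ T j - T i + E) →
        ∀ I ⊆ Finset.Icc 1 m, dist (a 0 • o)
          (insertionProd a (fun i => β (k i) * p i * (β (k i))⁻¹) (a m) (I.sort (· ≤ ·)) • o) ≤
          T m - T 0 + (I.card + 1) * (E + D) := by
  have hK := ha.K_nonneg
  obtain ⟨κ', hκ', hB⟩ := ha.exists_behrstock hX
  obtain ⟨R', hR', hE⟩ := ha.exists_dist_axis_le
  set R := ∑ k, dist o (e k • o) with hR
  have hR0 : 0 ≤ R := Finset.sum_nonneg fun _ _ => dist_nonneg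
  have hRk : ∀ k, dist o (e k • o) ≤ R := fun k =>
    Finset.single_le_sum (f := fun k => dist o (e k • o)) (fun _ _ => dist_nonneg)
      (Finset.mem_univ k)
  set Λ := κ' + R + K + κ with hΛ
  obtain ⟨β, hβ⟩ := ha.exists_conjugators hX he Λ Λ
  set D := ∑ k, ∑ p ∈ P, dist o ((β k * p * (β k)⁻¹) • o) with hD
  have hD0 : 0 ≤ D := Finset.sum_nonneg fun _ _ => Finset.sum_nonneg fun _ _ => dist_nonneg
  have hDk : ∀ k, ∀ p ∈ P, dist o ((β k * p * (β k)⁻¹) • o) ≤ D := fun k p hp =>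
    (Finset.single_le_sum (f := fun p => dist o ((β k * p * (β k)⁻¹) • o))
      (fun _ _ => dist_nonneg) hp).trans
    (Finset.single_le_sum (f := fun k => ∑ p ∈ P, dist o ((β k * p * (β k)⁻¹) • o))
      (fun _ _ => Finset.sum_nonneg fun _ _ => dist_nonneg) (Finset.mem_univ k))
  -- If the axes at positions `i` and `j` were coarsely equal, `a j o` would be close to the axis at
  -- `i` and also project near `a i o`, so the two orbit points would be less than `L` apart.
  set L := 4 * R + 2 * R' + 2 * K + κ + 1 with hL
  refine ⟨L, by positivity, D, hD0, β, fun m a k p hp hproj hsep => ?_⟩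
  set w := fun i => β (k i) * p i * (β (k i))⁻¹ with hw
  have hins : IsInsertable o h π κ R Λ m a (fun i => e (k i)) w := by
    refine ⟨fun i _ => hRk _, hproj, fun i j hij hj hmem => ?_,
      fun i hi v hv => hβ (k i) (p i) (hp i hi) v hv⟩
    set z := (a i)⁻¹ * a j with hz
    clear_value z
    obtain ⟨l, hl⟩ := hE _ hmem
    set y := h ^ l • o with hy
    have hyp : π y = y := ha.proj_zpow l
    have h1 : dist ((e (k i))⁻¹ • z • o) y ≤ R' + R := by
      have h2 := dist_triangle ((e (k i))⁻¹ • z • o) (((e (k i))⁻¹ * (z * e (k j))) • o) y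
      rw [mul_smul, mul_smul, dist_smul, dist_smul] at h2
      rw [mul_smul, mul_smul] at hl
      linarith [hRk (k j)]
    have h2 := ha.proj.dist_proj_proj_le ((e (k i))⁻¹ • z • o) y
    rw [hyp] at h2
    have h3 := ha.proj.dist_proj_proj_le ((e (k i))⁻¹ • o) o
    rw [ha.proj_base, ← dist_smul (e (k i)) ((e (k i))⁻¹ • o) o, smul_inv_smul] at h3
    have h4 := hproj i (hij.le.trans hj) j hj
    rw [← mul_smul, ← hz] at h4
    simp only [axisDist] at h4
    have h5 : dist o (z • o) = dist (a i • o) (a j • o) := by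
      rw [hz, mul_smul, ← dist_smul (a i), smul_inv_smul]
    have h6 : dist o (z • o) ≤ R + dist o ((e (k i))⁻¹ • z • o) := by
      have h7 := dist_triangle o (e (k i) • o) (z • o)
      rw [← dist_smul (e (k i)) o ((e (k i))⁻¹ • z • o), smul_inv_smul]
      linarith [hRk (k i)]
    have h7 := dist_triangle4 o (π ((e (k i))⁻¹ • o)) (π ((e (k i))⁻¹ • z • o)) y
    rw [dist_comm o (π _)] at h7
    have h8 := dist_triangle_right o ((e (k i))⁻¹ • z • o) y
    have h9 := hsep i j hij hj
    linarith [hRk (k i)]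
  have hsub : ∀ I ⊆ Finset.Icc 1 m, ∀ j ∈ I.sort (· ≤ ·), j ≤ m := fun I hI j hj =>
    (Finset.mem_Icc.1 (hI ((Finset.mem_sort _).1 hj))).2
  have hpw : ∀ I : Finset ℕ, (I.sort (· ≤ ·)).Pairwise (· < ·) := fun I =>
    (Finset.sortedLT_sort I).pairwise
  refine ⟨fun I hI J hJ heq => ?_, fun T E hE0 hT I hI => ?_⟩
  · have := hins.insertionProd_injective ha hκ' hR0 hΛ hB _ _ (hpw I) (hpw J) (hsub I hI)
      (hsub J hJ) heq
    simpa using congrArg List.toFinset this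
  · have := dist_insertionProd_le hE0 hD0 hT (fun i hi => hDk (k i) (p i) (hp i hi))
      (I.sort (· ≤ ·)) 0 (Nat.zero_le _) (List.pairwise_cons.2 ⟨fun j hj =>
        (Finset.mem_Icc.1 (hI ((Finset.mem_sort _).1 hj))).1, hpw I⟩) (hsub I hI)
    rwa [Finset.length_sort] at this

end InsertionProd

/-! ### Insertions along admissible elements and along an axis -/

section Admissible

variable {G X : Type*} [Group G] [MetricSpace X] [MulAction G X] [IsIsometricSMul G X]
  {o : X} {h : G} {π : X → X} {K c : ℝ}

omit [IsIsometricSMul G X] in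
/-- Positions along a geodesic of the orbit points that witness admissibility. -/
lemma IsAdmissible.exists_positions {θ L M : ℝ} {g : G} (hg : IsAdmissible o θ L M g) :
    ∃ (m : ℕ) (a : ℕ → G) (T : ℕ → ℝ), ⌊θ * dist o (g • o)⌋₊ ≤ m ∧ a 0 = 1 ∧ a m = g ∧
      0 ≤ T 0 ∧ T m ≤ dist o (g • o) ∧ (∀ i j, i ≤ j → j ≤ m → T i ≤ T j) ∧
      (∀ i ≤ m, ∀ j ≤ m, dist (a i • o) (a j • o) ≤ |T i - T j| + 2 * M) ∧
      (∀ i ≤ m, ∀ j ≤ m, |T i - T j| ≤ dist (a i • o) (a j • o) + 2 * M) ∧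
      (∀ i j, i < j → j ≤ m → L ≤ dist (a i • o) (a j • o)) := by
  obtain ⟨γ, ⟨hγ0, -, hγ⟩, m, x, a, hm, ha0, ham, hx, hmono, hclose, hsep⟩ := hg
  set ℓ := dist o (g • o) with hℓ
  have ht : ∀ i, ∃ t, i ≤ m → t ∈ Icc (0 : ℝ) ℓ ∧ γ t = x i := fun i => by
    by_cases hi : i ≤ m
    · obtain ⟨t, h1, h2⟩ := hx i hi
      exact ⟨t, fun _ => ⟨h1, h2⟩⟩
    · exact ⟨0, fun h' => absurd h' hi⟩
  choose t ht using ht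
  have hxt : ∀ i ≤ m, dist o (x i) = t i := fun i hi => by
    have h1 := ht i hi
    rw [← h1.2, ← hγ0, hγ 0 ⟨le_rfl, dist_nonneg⟩ _ h1.1, zero_sub, abs_neg,
      abs_of_nonneg h1.1.1]
  have hxx : ∀ i ≤ m, ∀ j ≤ m, dist (x i) (x j) = |t i - t j| := fun i hi j hj => by
    rw [← (ht i hi).2, ← (ht j hj).2, hγ _ (ht i hi).1 _ (ht j hj).1]
  refine ⟨m, a, t, hm, ha0, ham, (ht 0 (Nat.zero_le _)).1.1, (ht m le_rfl).1.2, ?_, ?_, ?_, hsep⟩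
  · intro i j hij
    induction j, hij using Nat.le_induction with
    | base => exact fun _ => le_rfl
    | succ j hij ih =>
      intro hj
      have h1 := hmono j hj
      rw [hxt j (by omega), hxt (j + 1) hj] at h1
      exact (ih (by omega)).trans h1
  · intro i hi j hj
    rw [← hxx i hi j hj]
    have := dist_triangle4 (a i • o) (x i) (x j) (a j • o)
    rw [dist_comm (x j) (a j • o)] at this
    linarith [hclose i hi, hclose j hj]
  · intro i hi j hj
    rw [← hxx i hi j hj]
    have := dist_triangle4 (x i) (a i • o) (a j • o) (x j)
    rw [dist_comm (x i) (a i • o)] at this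
    linarith [hclose i hi, hclose j hj]

variable [ProperSpace X] [ProperlyDiscontinuousSMul G X]

/-- Each coset of a confined subgroup that contains an admissible element contains many elements
of comparable length. -/
lemma IsAxis.exists_insertion_of_isAdmissible (ha : IsAxis o h π K c) (hX : IsGeodesicSpace X)
    {e : Fin 3 → G} {P : Finset G} (he : ∀ k, ∀ p ∈ P, (e k)⁻¹ * p * e k ∉ EPlus h)
    (hind : ∀ k l, k ≠ l → (e k)⁻¹ * e l ∉ axisStabilizer h) {M : ℝ} (hM : 0 < M) :
    ∃ L > 0, ∃ D > 0, ∀ (θ : ℝ) (H : Subgroup G), IsConfiningSet H P →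
      ∀ g : G, IsAdmissible o θ L M g → ∃ m : ℕ, ⌊θ * dist o (g • o)⌋₊ ≤ m ∧
        ∃ Φ : Finset ℕ → G, (∀ I ⊆ Finset.Icc 1 m, ∃ x ∈ H, Φ I = x * g) ∧
          (∀ I ⊆ Finset.Icc 1 m, ∀ J ⊆ Finset.Icc 1 m, Φ I = Φ J → I = J) ∧
          ∀ I ⊆ Finset.Icc 1 m, dist o (Φ I • o) ≤ dist o (g • o) + (I.card + 1) * D := by
  have hK := ha.K_nonneg
  obtain ⟨κ, hκ, hκ'⟩ := ha.exists_axisDist_le hX hind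
  obtain ⟨L, hL, D, hD, β, hβ⟩ := ha.exists_insertion hX he
    (show 0 ≤ κ + 2 * K + 6 * M by positivity)
  refine ⟨L, hL, 2 * M + D, by positivity, fun θ H hH g hg => ?_⟩
  obtain ⟨m, a, T, hm, ha0, ham, hT0, hTm, hTmono, hT1, hT2, hsep⟩ := hg.exists_positions
  -- At each position an axis is chosen to which both ends of the path project near the base point;
  -- monotonicity passes this on to all intermediate `a j`.
  choose k hk0 hkm using fun i => hκ' ((a i)⁻¹ • a 0 • o) ((a i)⁻¹ • a m • o)
  choose p hpP _ y hyH hy using fun i => hH (a i * β (k i))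
  have hproj : ∀ i ≤ m, ∀ j ≤ m,
      axisDist π (e (k i)) o ((a i)⁻¹ • a j • o) ≤ κ + 2 * K + 6 * M := by
    intro i hi j hj
    have key : ∀ l ≤ m, axisDist π (e (k i)) o ((a i)⁻¹ • a l • o) ≤ κ →
        |T i - T j| + |T j - T l| = |T i - T l| →
        axisDist π (e (k i)) o ((a i)⁻¹ • a j • o) ≤ κ + 2 * K + 6 * M := by
      intro l hl h1 h2
      -- Three distances between orbit points are compared with distances along the geodesic, each
      -- with error `2 * M`.
      have h3 := ha.axisDist_mono (e (k i)) (s := o) (a := (a i)⁻¹ • a j • o)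
        (b := (a i)⁻¹ • a l • o) (ε := 6 * M) (by positivity) (by
          have e1 : ∀ n, dist o ((a i)⁻¹ • a n • o) = dist (a i • o) (a n • o) := fun n => by
            rw [← dist_smul (a i) o ((a i)⁻¹ • _), smul_inv_smul]
          rw [e1, dist_smul, e1]
          linarith [hT1 i hi j hj, hT1 j hj l hl, hT2 i hi l hl])
      linarith
    rcases le_total i j with hij | hij
    · refine key m le_rfl (hkm i) ?_
      have h1 := hTmono i j hij hj
      have h2 := hTmono j m hj le_rfl
      rw [abs_of_nonpos (by linarith), abs_of_nonpos (by linarith), abs_of_nonpos (by linarith)]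
      ring
    · refine key 0 (Nat.zero_le _) (hk0 i) ?_
      have h1 := hTmono j i hij hi
      have h2 := hTmono 0 j (Nat.zero_le _) hj
      rw [abs_of_nonneg (by linarith), abs_of_nonneg (by linarith), abs_of_nonneg (by linarith)]
      ring
  obtain ⟨hinj, hlen⟩ := hβ m a k p (fun i _ => hpP i) hproj hsep
  refine ⟨m, hm, _, fun I hI => ?_, hinj, fun I hI => ?_⟩
  · rw [ham]
    refine exists_mem_insertionProd_eq (m := m) (fun i _ => ?_) g _ fun j hj =>
      (Finset.mem_Icc.1 (hI ((Finset.mem_sort _).1 hj))).2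
    have : a i * (β (k i) * p i * (β (k i))⁻¹) * (a i)⁻¹ = y i := by
      rw [hy i]; group
    rw [this]; exact hyH i
  · have h1 := hlen T (2 * M) (by positivity) (fun i j hij hj => by
      have h1 := hT1 i (hij.le.trans hj) j hj
      rwa [abs_sub_comm, abs_of_nonneg (by linarith [hTmono i j hij.le hj])] at h1) I hI
    rw [ha0, one_smul] at h1
    linarith

/-- Linearly many independent insertions along the powers of a contracting element. -/
lemma IsAxis.exists_exponential_family (ha : IsAxis o h π K c) (hX : IsGeodesicSpace X)
    {e : Fin 3 → G} {P : Finset G} (he : ∀ k, ∀ p ∈ P, (e k)⁻¹ * p * e k ∉ EPlus h)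
    (hind : ∀ k l, k ≠ l → (e k)⁻¹ * e l ∉ axisStabilizer h) (hPne : P.Nonempty) :
    ∃ D : ℕ, 0 < D ∧ ∀ m : ℕ, ∃ Φ : Finset ℕ → G,
      (∀ I ⊆ Finset.Icc 1 m, ∀ J ⊆ Finset.Icc 1 m, Φ I = Φ J → I = J) ∧
      ∀ I ⊆ Finset.Icc 1 m, dist o (Φ I • o) ≤ D * (m + 1) := by
  have hc := ha.one_le
  obtain ⟨p, hp⟩ := hPne
  obtain ⟨B, hB, hB'⟩ := ha.exists_proj_bound hX
  -- At most one `e k` lies in the stabilizer; for any other, the axis of `h` has bounded projection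
  -- to the translate, so powers of `h` can serve as positions.
  obtain ⟨k, hk⟩ : ∃ k, (e k)⁻¹ ∉ axisStabilizer h := by
    by_contra hcon
    push Not at hcon
    refine hind 0 1 (by decide) (mul_mem (hcon 0) ?_)
    simpa using inv_mem (hcon 1)
  obtain ⟨L, hL, D, hD, β, hβ⟩ := ha.exists_insertion hX he hB
  obtain ⟨Q, hQ⟩ := exists_nat_gt ((L + c) * c)
  have hQ' : (L + c) ≤ Q / c := by rw [le_div_iff₀ (by linarith)]; exact hQ.le
  obtain ⟨D', hD'⟩ := exists_nat_gt (c * Q + c + D)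
  have hD0 : 0 < D' := by
    have : (0 : ℝ) < D' := lt_of_le_of_lt (by positivity) hD'
    exact_mod_cast this
  refine ⟨D', hD0, fun m => ?_⟩
  obtain ⟨hinj, hlen⟩ := hβ m (fun i => h ^ ((Q * i : ℕ) : ℤ)) (fun _ => k) (fun _ => p)
    (fun _ _ => hp)
    (fun i _ j _ => by
      have h1 := hB' _ hk 0 (-((Q * i : ℕ) : ℤ) + ((Q * j : ℕ) : ℤ))
      simp only [axisDist]
      rw [zpow_zero, one_smul, zpow_add, zpow_neg, mul_smul] at h1
      exact h1)
    (fun i j hij _ => by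
      refine le_trans ?_ (ha.lower _ _)
      have h1 : (1 : ℝ) ≤ |(i : ℝ) - j| := by
        have : (1 : ℤ) ≤ |(i : ℤ) - j| := Int.one_le_abs (by omega)
        exact_mod_cast this
      have h2 : (Q : ℝ) ≤ |(((Q * i : ℕ) : ℤ) : ℝ) - ((Q * j : ℕ) : ℤ)| := by
        push_cast
        rw [← mul_sub, abs_mul, Nat.abs_cast]
        exact le_mul_of_one_le_right (by positivity) h1
      have h3 : (Q : ℝ) / c ≤ |(((Q * i : ℕ) : ℤ) : ℝ) - ((Q * j : ℕ) : ℤ)| / c := by gcongr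
      linarith)
  refine ⟨_, hinj, fun I hI => ?_⟩
  have h1 := hlen (fun i => c * Q * i) c (by linarith) (fun i j hij _ => by
    have h1 := ha.upper ((Q * i : ℕ) : ℤ) ((Q * j : ℕ) : ℤ)
    have hij' : (i : ℝ) ≤ j := by exact_mod_cast hij.le
    push_cast at h1
    rw [← mul_sub, abs_mul, Nat.abs_cast, abs_sub_comm, abs_of_nonneg (by linarith)] at h1
    push_cast
    linarith) I hI
  have hcard : (I.card : ℝ) ≤ m := by
    have := Finset.card_le_card hI
    rw [Nat.card_Icc, Nat.add_sub_cancel] at this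
    exact_mod_cast this
  simp only [mul_zero, Nat.cast_zero, zpow_zero, one_smul, sub_zero] at h1
  refine h1.trans ?_
  have h2 : ((I.card : ℝ) + 1) * (c + D) ≤ (m + 1) * (c + D) := by gcongr
  have h3 : (c * Q + c + D) * (m + 1) ≤ D' * (m + 1) := by gcongr
  have h4 : 0 ≤ c * Q := by positivity
  nlinarith

end Admissible

/-! ### Poincaré series and growth rates -/

section Growth

variable {G X : Type*} [Group G] [MetricSpace X] [MulAction G X]

/-- The Poincaré series `∑ exp (-s d(o, g o))` of a subset of `G`. -/
noncomputable def poincareSeries (o : X) (A : Set G) (s : ℝ) : ENNReal :=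
  ∑' g : A, ENNReal.ofReal (Real.exp (-s * dist o ((g : G) • o)))

lemma growthRate_le_of_poincareSeries_ne_top {o : X} {A : Set G} {t : ℝ} (ht : 0 ≤ t)
    (h : poincareSeries o A t ≠ ⊤) : growthRate o A ≤ t := by
  unfold growthRate
  rw [← ExpGrowth.expGrowthSup_exp (a := (t : EReal))]
  refine ExpGrowth.expGrowthSup_le_of_eventually_le h (Eventually.of_forall fun n => ?_)
  have h1 : ((A ∩ {g : G | dist o (g • o) ≤ n}).encard : ENNReal) *
      ENNReal.ofReal (Real.exp (-t * n)) ≤ poincareSeries o A t := by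
    rw [← ENNReal.tsum_set_const]
    calc ∑' _ : ↥(A ∩ {g : G | dist o (g • o) ≤ n}), ENNReal.ofReal (Real.exp (-t * n))
        ≤ ∑' g : ↥(A ∩ {g : G | dist o (g • o) ≤ n}),
            ENNReal.ofReal (Real.exp (-t * dist o ((g : G) • o))) := by
          refine ENNReal.tsum_le_tsum fun g => ENNReal.ofReal_le_ofReal (Real.exp_le_exp.2 ?_)
          have : dist o ((g : G) • o) ≤ n := g.2.2
          nlinarith
      _ ≤ poincareSeries o A t :=
          ENNReal.tsum_mono_subtype (fun g : G => ENNReal.ofReal (Real.exp (-t * dist o (g • o))))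
            inter_subset_left
  have h2 : EReal.exp ((t : EReal) * (n : ℕ)) = ENNReal.ofReal (Real.exp (t * n)) := by
    rw [← EReal.exp_coe]; norm_cast
  have h3 : ENNReal.ofReal (Real.exp (-t * n)) * ENNReal.ofReal (Real.exp (t * n)) = 1 := by
    rw [← ENNReal.ofReal_mul (Real.exp_nonneg _), ← Real.exp_add]; simp
  rw [h2]
  calc ((A ∩ {g : G | dist o (g • o) ≤ n}).encard : ENNReal)
      = ((A ∩ {g : G | dist o (g • o) ≤ n}).encard : ENNReal) *
        ENNReal.ofReal (Real.exp (-t * n)) * ENNReal.ofReal (Real.exp (t * n)) := by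
        rw [mul_assoc, h3, mul_one]
    _ ≤ _ := by gcongr

lemma tsum_mul_exp_ne_top {b : ℕ → ENNReal} (hb : ∀ n, b n ≠ ⊤) {s s' : ℝ} (hs : s' < s) {n₀ : ℕ}
    (hn₀ : ∀ n ≥ n₀, b n ≤ ENNReal.ofReal (Real.exp (s' * n))) :
    ∑' n : ℕ, b n * ENNReal.ofReal (Real.exp (-s * (n - 1))) ≠ ⊤ := by
  rw [← (ENNReal.summable).sum_add_tsum_nat_add' (k := n₀)]
  refine ENNReal.add_ne_top.2 ⟨ENNReal.sum_ne_top.2 fun n _ =>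
    ENNReal.mul_ne_top (hb n) ENNReal.ofReal_ne_top, ?_⟩
  have hr1 : ENNReal.ofReal (Real.exp (s' - s)) < 1 := by
    rw [ENNReal.ofReal_lt_one, Real.exp_lt_one_iff]; linarith
  have hterm : ∀ n : ℕ, b (n + n₀) * ENNReal.ofReal (Real.exp (-s * ((n + n₀ : ℕ) - 1))) ≤
      ENNReal.ofReal (Real.exp s) * ENNReal.ofReal (Real.exp (s' - s)) ^ n := by
    intro n
    refine (mul_le_mul_left (hn₀ (n + n₀) (Nat.le_add_left _ _)) _).trans ?_
    rw [← ENNReal.ofReal_pow (Real.exp_nonneg _), ← ENNReal.ofReal_mul (Real.exp_nonneg _),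
      ← ENNReal.ofReal_mul (Real.exp_nonneg _), ← Real.exp_nat_mul, ← Real.exp_add, ← Real.exp_add]
    refine ENNReal.ofReal_le_ofReal (Real.exp_le_exp.2 ?_)
    have : (0 : ℝ) ≤ n₀ * (s - s') := mul_nonneg (Nat.cast_nonneg _) (by linarith)
    push_cast
    linarith
  refine ne_top_of_le_ne_top ?_ (ENNReal.tsum_le_tsum hterm)
  rw [ENNReal.tsum_mul_left, ENNReal.tsum_geometric]
  refine ENNReal.mul_ne_top ENNReal.ofReal_ne_top (ENNReal.inv_ne_top.2 ?_)
  exact (tsub_pos_of_lt hr1).ne'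

lemma poincareSeries_univ_eq (o : X) (s : ℝ) : poincareSeries o (univ : Set G) s =
    ∑' g : G, ENNReal.ofReal (Real.exp (-s * dist o (g • o))) :=
  tsum_univ fun g : G => ENNReal.ofReal (Real.exp (-s * dist o (g • o)))

lemma poincareSeries_univ_le {o : X} {s : ℝ} (hs0 : 0 ≤ s) :
    poincareSeries o (univ : Set G) s ≤ ∑' n : ℕ, ({g : G | dist o (g • o) ≤ n}.encard : ENNReal) *
      ENNReal.ofReal (Real.exp (-s * (n - 1))) := by
  have e2 : ∀ n : ℕ, ({g : G | dist o (g • o) ≤ n}.encard : ENNReal) *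
      ENNReal.ofReal (Real.exp (-s * (n - 1))) = ∑' g : G, ({g : G | dist o (g • o) ≤ n}).indicator
      (fun _ => ENNReal.ofReal (Real.exp (-s * (n - 1)))) g := fun n => by
    rw [← tsum_subtype, ENNReal.tsum_set_const]
  rw [poincareSeries_univ_eq, tsum_congr e2, ENNReal.tsum_comm]
  refine ENNReal.tsum_le_tsum fun g => ?_
  -- Counting `g` in the ball whose radius is its length rounded up explains the exponent `n - 1` in
  -- the bound.
  obtain ⟨n, hn, hn'⟩ : ∃ n : ℕ, dist o (g • o) ≤ n ∧ (n : ℝ) - 1 ≤ dist o (g • o) :=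
    ⟨⌈dist o (g • o)⌉₊, Nat.le_ceil _, by
      linarith [Nat.ceil_lt_add_one (dist_nonneg (x := o) (y := g • o))]⟩
  refine le_trans ?_ (ENNReal.le_tsum n)
  rw [indicator_of_mem (show g ∈ {g : G | dist o (g • o) ≤ n} by rw [mem_ofPred_eq]; exact hn)]
  refine ENNReal.ofReal_le_ofReal (Real.exp_le_exp.2 ?_)
  nlinarith

lemma poincareSeries_univ_ne_top [ProperSpace X] [ProperlyDiscontinuousSMul G X] {o : X} {s : ℝ}
    (hs0 : 0 ≤ s) (hs : growthRate o (univ : Set G) < s) :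
    poincareSeries o (univ : Set G) s ≠ ⊤ := by
  obtain ⟨s', h1, h2⟩ := EReal.lt_iff_exists_real_btwn.1 hs
  obtain ⟨n₀, hn₀⟩ := eventually_atTop.1 (ExpGrowth.eventually_le_exp h1)
  refine ne_top_of_le_ne_top (tsum_mul_exp_ne_top (n₀ := n₀) (fun n => ?_)
    (EReal.coe_lt_coe_iff.1 h2) fun n hn => ?_) (poincareSeries_univ_le hs0)
  · rw [(finite_setOf_dist_le o (n : ℝ)).encard_eq_coe_toFinset_card]
    simp
  · have := hn₀ n hn
    rw [univ_inter] at this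
    refine this.trans (le_of_eq ?_)
    rw [← EReal.exp_coe]; norm_cast

lemma growthRate_pos_of_exponential_family {o : X} {D : ℕ} (hD : 0 < D)
    (h : ∀ m : ℕ, ∃ Φ : Finset ℕ → G,
      (∀ I ⊆ Finset.Icc 1 m, ∀ J ⊆ Finset.Icc 1 m, Φ I = Φ J → I = J) ∧
      ∀ I ⊆ Finset.Icc 1 m, dist o (Φ I • o) ≤ D * (m + 1)) :
    0 < growthRate o (univ : Set G) := by
  have hlog : 0 < Real.log 2 := Real.log_pos one_lt_two
  have ha : (0 : EReal) < ((Real.log 2 / (2 * D) : ℝ) : EReal) := by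
    have : 0 < Real.log 2 / (2 * D) := by positivity
    exact_mod_cast this
  refine ha.trans_le (Frequently.le_expGrowthSup ?_)
  refine frequently_atTop.2 fun n₀ => ⟨D * (n₀ + 1 + 1), by nlinarith, ?_⟩
  set m := n₀ + 1 with hm
  obtain ⟨Φ, hinj, hlen⟩ := h m
  have h1 : ((2 ^ m : ℕ) : ENat) ≤
      ((univ : Set G) ∩ {g : G | dist o (g • o) ≤ (D * (m + 1) : ℕ)}).encard := by
    have h2 : InjOn Φ ((Finset.Icc 1 m).powerset : Set (Finset ℕ)) := fun I hI J hJ e =>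
      hinj I (Finset.mem_powerset.1 hI) J (Finset.mem_powerset.1 hJ) e
    have h3 := h2.encard_image
    rw [Set.encard_coe_eq_coe_finsetCard, Finset.card_powerset, Nat.card_Icc,
      Nat.add_sub_cancel] at h3
    rw [← h3]
    refine encard_le_encard ?_
    rintro _ ⟨I, hI, rfl⟩
    refine ⟨mem_univ _, ?_⟩
    have := hlen I (Finset.mem_powerset.1 hI)
    simp only [mem_ofPred_eq]
    push_cast
    exact this
  have h4 : ((2 ^ m : ℕ) : ENNReal) ≤
      (((univ : Set G) ∩ {g : G | dist o (g • o) ≤ (D * (m + 1) : ℕ)}).encard : ENNReal) := by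
    have := ENat.toENNReal_le.2 h1
    simpa using this
  refine le_trans ?_ h4
  have h5 : EReal.exp (((Real.log 2 / (2 * D) : ℝ) : EReal) * ((D * (m + 1) : ℕ) : EReal)) =
      ENNReal.ofReal (Real.exp (Real.log 2 / (2 * D) * (D * (m + 1) : ℕ))) := by
    rw [← EReal.exp_coe]; norm_cast
  rw [h5, ← ENNReal.ofReal_natCast]
  refine ENNReal.ofReal_le_ofReal ?_
  have h6 : Real.log 2 / (2 * D) * (D * (m + 1) : ℕ) ≤ m * Real.log 2 := by
    have hD' : (0 : ℝ) < D := by exact_mod_cast hD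
    have hm1 : (1 : ℝ) ≤ m := by rw [hm]; push_cast; linarith [(Nat.cast_nonneg n₀ : (0 : ℝ) ≤ n₀)]
    have : Real.log 2 / (2 * D) * (D * (m + 1) : ℕ) = Real.log 2 * ((m + 1) / 2) := by
      push_cast; field_simp
    rw [this]
    nlinarith
  calc Real.exp _ ≤ Real.exp (m * Real.log 2) := Real.exp_le_exp.2 h6
    _ = ((2 ^ m : ℕ) : ℝ) := by
      rw [Real.exp_nat_mul, Real.exp_log two_pos]; push_cast; rfl

/-- Since `m + 1 ≥ θ * r`, the power gains a factor `exp (δ * r)`; the constant on the left absorbs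
the rounding and the extra `D`. -/
lemma exp_mul_le_exp_mul_one_add_pow {θ s δ D r : ℝ} {m : ℕ} (hm : ⌊θ * r⌋₊ ≤ m) (hr : 0 ≤ r)
    (hδ : δ ≤ θ * Real.log (1 + Real.exp (-s * D))) :
    Real.exp (-s * D - Real.log (1 + Real.exp (-s * D))) * Real.exp (-(s - δ) * r) ≤
      Real.exp (-s * (r + D)) * (Real.exp (-s * D) + 1) ^ m := by
  set l := Real.log (1 + Real.exp (-s * D)) with hl
  have hpos := Real.exp_pos (-s * D)
  have hl0 : 0 ≤ l := Real.log_nonneg (by linarith)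
  have h1 : (Real.exp (-s * D) + 1) ^ m = Real.exp (m * l) := by
    rw [Real.exp_nat_mul, hl, Real.exp_log (by linarith), add_comm]
  rw [h1, ← Real.exp_add, ← Real.exp_add]
  refine Real.exp_le_exp.2 ?_
  have h2 : θ * r ≤ m + 1 := by
    have := Nat.lt_floor_add_one (θ * r)
    have h3 : ((⌊θ * r⌋₊ : ℕ) : ℝ) ≤ m := by exact_mod_cast hm
    linarith
  have h3 : δ * r ≤ θ * l * r := mul_le_mul_of_nonneg_right hδ hr
  have h4 : θ * r * l ≤ (m + 1) * l := mul_le_mul_of_nonneg_right h2 hl0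
  nlinarith

/-- If every element of `A` comes with exponentially many elements of `G` of comparable length, and
these elements are all different, then the Poincaré series of `A` converges beyond that of `G`. -/
lemma poincareSeries_ne_top_of_insertion {o : X} {A : Set G} {θ s δ D : ℝ} (hs : 0 ≤ s)
    (hδ : δ ≤ θ * Real.log (1 + Real.exp (-s * D))) {m : G → ℕ} {Φ : G → Finset ℕ → G}
    (hm : ∀ g ∈ A, ⌊θ * dist o (g • o)⌋₊ ≤ m g)
    (hinj : ∀ g ∈ A, ∀ g' ∈ A, ∀ I ⊆ Finset.Icc 1 (m g), ∀ J ⊆ Finset.Icc 1 (m g'),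
      Φ g I = Φ g' J → g = g' ∧ I = J)
    (hlen : ∀ g ∈ A, ∀ I ⊆ Finset.Icc 1 (m g),
      dist o (Φ g I • o) ≤ dist o (g • o) + (I.card + 1) * D)
    (htop : poincareSeries o (univ : Set G) s ≠ ⊤) : poincareSeries o A (s - δ) ≠ ⊤ := by
  set C := Real.exp (-s * D - Real.log (1 + Real.exp (-s * D))) with hC
  have hC0 : 0 < C := Real.exp_pos _
  have hsum : ∀ g ∈ A, ENNReal.ofReal C * ENNReal.ofReal (Real.exp (-(s - δ) * dist o (g • o))) ≤
      ∑' I : (Finset.Icc 1 (m g)).powerset,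
        ENNReal.ofReal (Real.exp (-s * dist o (Φ g I • o))) := by
    intro g hg
    rw [Finset.tsum_subtype (Finset.Icc 1 (m g)).powerset
      (fun I => ENNReal.ofReal (Real.exp (-s * dist o (Φ g I • o)))),
      ← ENNReal.ofReal_mul hC0.le, ← ENNReal.ofReal_sum_of_nonneg fun _ _ => Real.exp_nonneg _]
    refine ENNReal.ofReal_le_ofReal
      ((exp_mul_le_exp_mul_one_add_pow (hm g hg) dist_nonneg hδ).trans ?_)
    -- The binomial theorem sums the length penalties over all subsets of positions.
    have e1 := Finset.sum_pow_mul_eq_add_pow (Real.exp (-s * D)) 1 (Finset.Icc 1 (m g))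
    rw [Nat.card_Icc, Nat.add_sub_cancel] at e1
    rw [← e1, Finset.mul_sum]
    refine Finset.sum_le_sum fun I hI => ?_
    rw [one_pow, mul_one, ← Real.exp_nat_mul, ← Real.exp_add]
    refine Real.exp_le_exp.2 ?_
    have := hlen g hg I (Finset.mem_powerset.1 hI)
    nlinarith
  have hle : ENNReal.ofReal C * poincareSeries o A (s - δ) ≤ poincareSeries o (univ : Set G) s := by
    rw [poincareSeries_univ_eq, poincareSeries, ← ENNReal.tsum_mul_left]
    calc _ ≤ ∑' g : A, ∑' I : (Finset.Icc 1 (m g)).powerset,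
          ENNReal.ofReal (Real.exp (-s * dist o (Φ g I • o))) :=
        ENNReal.tsum_le_tsum fun g => hsum g g.2
      _ = ∑' x : Σ g : A, (Finset.Icc 1 (m g)).powerset,
          ENNReal.ofReal (Real.exp (-s * dist o (Φ x.1 x.2 • o))) := by
        rw [ENNReal.tsum_sigma']
      _ ≤ _ := by
        refine ENNReal.tsum_comp_le_tsum_of_injective
          (f := fun x : Σ g : A, (Finset.Icc 1 (m g)).powerset => Φ x.1 x.2) ?_
          (fun g => ENNReal.ofReal (Real.exp (-s * dist o (g • o))))
        rintro ⟨⟨g, hg⟩, I, hI⟩ ⟨⟨g', hg'⟩, J, hJ⟩ e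
        obtain ⟨rfl, rfl⟩ := hinj g hg g' hg' I (Finset.mem_powerset.1 hI) J
          (Finset.mem_powerset.1 hJ) e
        rfl
  intro h
  rw [h, ENNReal.mul_top (by simpa using hC0)] at hle
  exact htop (top_le_iff.1 hle)

end Growth

end ConfinedGrowth

/-! ### The growth gap -/

open ConfinedGrowth
theorem theorem4p1 {G X : Type*} [Group G] [MetricSpace X] [ProperSpace X]
    [MulAction G X] [IsIsometricSMul G X] [ProperlyDiscontinuousSMul G X]
    (hX : IsGeodesicSpace X) (o : X)
    (hG : ¬ IsElementary G)
    (hcontr : ∃ h : G, IsContractingElement o h)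
    (hfin : growthRate o (Set.univ : Set G) < ⊤)
    (P : Finset G) (hP : Disjoint (P : Set G) (ellipticRadical G o))
    (M : ℝ) (hM : 0 < M) :
    ∃ L : ℝ, 0 < L ∧ ∀ θ : ℝ, 0 < θ →
      ∃ δ : ℝ, 0 < δ ∧
        ∀ H : Subgroup G, IsConfiningSet H P →
          ∀ S : Set G, Subgroup.IsComplement (H : Set G) S →
            growthRate o {g ∈ S | IsAdmissible o θ L M g} < growthRate o (Set.univ : Set G) ∧
            growthRate o {g ∈ S | IsAdmissible o θ L M g} + (δ : EReal) ≤
              growthRate o (Set.univ : Set G) := by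
  obtain ⟨h, hh⟩ := hcontr
  obtain ⟨π, K, c, ha⟩ := hh.exists_isAxis hX
  obtain ⟨e, he, hind⟩ := ha.exists_three_conj hG P hP
  obtain ⟨L, hL, D, hD, hins⟩ := ha.exists_insertion_of_isAdmissible hX he hind hM
  refine ⟨L, hL, fun θ hθ => ?_⟩
  rcases P.eq_empty_or_nonempty with rfl | hPne
  -- The empty set confines no subgroup, so any `δ` will do.
  · exact ⟨1, one_pos, fun H hH => by obtain ⟨p, hp, -⟩ := hH 1; simp at hp⟩
  obtain ⟨D', hD', hfam⟩ := ha.exists_exponential_family hX he hind hPne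
  have hpos := growthRate_pos_of_exponential_family hD' hfam
  obtain ⟨ω, hω⟩ : ∃ ω : ℝ, growthRate o (univ : Set G) = ω :=
    ⟨_, (EReal.coe_toReal hfin.ne (EReal.bot_lt_zero.trans hpos).ne').symm⟩
  rw [hω] at hpos
  have hω0 : 0 < ω := by exact_mod_cast hpos
  -- Evaluating the gain at `s = ω + 1`, the worst case, makes it valid for all `s ≤ ω + 1` and
  -- independent of `H` and `S`.
  set η := θ * Real.log (1 + Real.exp (-(ω + 1) * D)) with hη
  have hη0 : 0 < η :=
    mul_pos hθ (Real.log_pos (by linarith [Real.exp_pos (-(ω + 1) * D)]))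
  -- The bound `ω / 2` keeps `s - δ` nonnegative, as the comparison of growth with the Poincaré
  -- series requires; this is where positive growth enters.
  set δ := min η (ω / 2) with hδ
  have hδ0 : 0 < δ := lt_min hη0 (by linarith)
  refine ⟨δ, hδ0, fun H hH S hS => ?_⟩
  set A := {g ∈ S | IsAdmissible o θ L M g} with hA
  have hdata : ∀ g, ∃ (m : ℕ) (Φ : Finset ℕ → G), g ∈ A → ⌊θ * dist o (g • o)⌋₊ ≤ m ∧
      (∀ I ⊆ Finset.Icc 1 m, ∃ x ∈ H, Φ I = x * g) ∧
      (∀ I ⊆ Finset.Icc 1 m, ∀ J ⊆ Finset.Icc 1 m, Φ I = Φ J → I = J) ∧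
      ∀ I ⊆ Finset.Icc 1 m, dist o (Φ I • o) ≤ dist o (g • o) + (I.card + 1) * D := fun g => by
    by_cases hg : g ∈ A
    · obtain ⟨m, hm, Φ, h1⟩ := hins θ H hH g hg.2
      exact ⟨m, Φ, fun _ => ⟨hm, h1⟩⟩
    · exact ⟨0, fun _ => 1, fun h' => absurd h' hg⟩
  choose m Φ hmΦ using hdata
  have hgrowth : ∀ s : ℝ, ω < s → s ≤ ω + 1 → growthRate o A ≤ ((s - δ : ℝ) : EReal) := by
    intro s hs hs1
    have hδω : δ ≤ ω / 2 := min_le_right _ _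
    refine growthRate_le_of_poincareSeries_ne_top (by linarith)
      (poincareSeries_ne_top_of_insertion (by linarith) ?_ (fun g hg => (hmΦ g hg).1) ?_
        (fun g hg => (hmΦ g hg).2.2.2)
        (poincareSeries_univ_ne_top (by linarith) (by rw [hω]; exact_mod_cast hs)))
    · refine (min_le_left _ _).trans ?_
      rw [hη]
      gcongr
    · intro g hg g' hg' I hI J hJ heq
      obtain ⟨x, hx, e1⟩ := (hmΦ g hg).2.1 I hI
      obtain ⟨y, hy, e2⟩ := (hmΦ g' hg').2.1 J hJ
      have e3 : ((⟨x, hx⟩ : (H : Set G)), (⟨g, hg.1⟩ : S)) =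
          ((⟨y, hy⟩ : (H : Set G)), (⟨g', hg'.1⟩ : S)) :=
        hS.injective (by simp only; rw [← e1, ← e2, heq])
      have e4 : g = g' := congrArg (fun z => (z.2 : G)) e3
      subst e4
      exact ⟨rfl, (hmΦ g hg).2.2.1 I hI J hJ heq⟩
  have hle : growthRate o A ≤ ((ω - δ : ℝ) : EReal) := by
    by_contra hcon
    obtain ⟨r, h1, h2⟩ := EReal.lt_iff_exists_real_btwn.1 (not_le.1 hcon)
    have h1 : ω - δ < r := by exact_mod_cast h1
    -- As `r > ω - δ`, this exponent lies above `ω` and yields a growth bound of at most `r`.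
    have h3 := hgrowth (min (r + δ) (ω + 1)) (lt_min (by linarith) (by linarith)) (min_le_right _ _)
    refine absurd (h2.trans_le h3) (not_lt.2 ?_)
    have : min (r + δ) (ω + 1) ≤ r + δ := min_le_left _ _
    exact_mod_cast (by linarith : min (r + δ) (ω + 1) - δ ≤ r)
  rw [hω]
  constructor
  · refine hle.trans_lt ?_
    exact_mod_cast (by linarith : ω - δ < ω)
  · calc growthRate o A + (δ : EReal) ≤ ((ω - δ : ℝ) : EReal) + (δ : EReal) := by gcongr
      _ = (ω : EReal) := by rw [← EReal.coe_add, sub_add_cancel]
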